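/- Conventions. Signatures are finite and multisorted: finitely many types and finitely many relational symbols, each with an arity that is a finite tuple of types. Structures and homomorphisms are typed, and $X\to Y$ means that there is a homomorphism from $X$ to $Y$. A *promise template* is a pair $(A,A')$ of structures of the same signature with $A\to A'$, where $A$ is finite and $A'$ may be infinite, such that some finite structure $X$ satisfies $X\not\to A'$. An instance of $\mathrm{PCSP}(A,A')$ is a finite structure $X$ of the same signature; it is positive if $X\to A$ and negative if $X\not\to A'$. A *reduction* from $\mathrm{PCSP}(A,A')$ to $\mathrm{PCSP}(B,B')$ is a map $\psi$ of structures such that, for all instances $X$, $X\to A$ implies $\psi(X)\to B$, and $X\not\to A'$ implies $\psi(X)\not\to B'$. *Datalog reductions.* A Datalog program over a signature $\Pi$ has finitely many typed rules whose bodies are lists of relational atoms and equalities, whose heads are atoms of auxiliary symbols, and a designated output symbol; its output is the relation of that symbol in the least fixed point. A Datalog interpretation from $\Pi$ to $\Delta$ consists of a program $\phi_t$ for each $\Delta$-type $t$ and a program $\phi_R$ for each $\Delta$-symbol $R$, the arity of $\phi_R$ being the concatenation of the arities of $\phi_t$ for the entries $t$ of the arity of $R$; it maps $X$ to the structure with domains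 $\phi_t(X)$ and relations given by $\phi_R(X)$. A union gadget from $\Delta$ to $\Sigma$ is a map of types together with a compatible map of symbols; it replaces the domains and relations by the disjoint unions of those with the same image. Write $\mathrm{PCSP}(A,A')\le_{\mathrm{DL}}\mathrm{PCSP}(B,B')$ if some composition $\upsilon\circ\phi$ of a union gadget $\upsilon$ with a Datalog interpretation $\phi$ (over some finite intermediate signature) is a reduction. *Consistency reductions.* For $k\ge 1$ and $X$ of the signature of $A$, let $(\mathcal F_K)_{K\subseteq X,\,|K|\le k}$ be the largest system of sets of partial homomorphisms $K\to A$ such that, for all $L\subseteq K$, every element of $\mathcal F_L$ extends to an element of $\mathcal F_K$ and every element of $\mathcal F_K$ restricts to an element of $\mathcal F_L$ (the outcome of enforcing $k$-consistency). The $k$-consistency reduction maps $X$ to the disjoint union of the powers $B^{\mathcal F_K}$ in which, for all $L\subseteq K$ and $b\colon\mathcal F_L\to B$, the element $b$ of $B^{\mathcal F_L}$ is identified with the element $b\circ\rho$ of $B^{\mathcal F_K}$, where $\rho\colon\mathcal F_K\to\mathcal F_L$ is restriction. *Minions.* A minion $M$ is a functor from finite sets to sets, $X\mapsto M^{(X)}$,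 with $M^{(X)}=\emptyset$ if and only if $X=\emptyset$; for $\pi\colon X\to Y$ and $f\in M^{(X)}$ write $f^\pi\in M^{(Y)}$ for the image of $f$. The minion $\mathrm{Pol}(A,A')$ has as elements of arity $X$ the homomorphisms $A^X\to A'$, with $f^\pi(a)=f(a\circ\pi)$. The minion $\omega(M)$ has as elements of arity $X$ the pairs $(Z,f)$ with $Z\subseteq X$ and $f\in M^{(Z)}$, with $(Z,f)^\pi=(\pi(Z),f^{\pi|_Z})$. A $(d,r)$-*homomorphism* from $M$ to $N$ assigns to each $f\in M^{(X)}$ a non-empty set $\xi(f)\subseteq N^{(X)}$ of at most $d$ elements such that, whenever $t_0,\dots,t_r\in M$ and maps $\pi_{i,j}$ ($0\le i<j\le r$) satisfy $t_j=t_i^{\pi_{i,j}}$ for $i<j$ and $\pi_{i,l}=\pi_{j,l}\circ\pi_{i,j}$ for $i<j<l$, there are $i<j$, $g_i\in\xi(t_i)$ and $g_j\in\xi(t_j)$ with $g_j=g_i^{\pi_{i,j}}$. *Gap sequences.* Let $D$ be a structure and $d,r\ge 0$. Call natural numbers $k_0\ge\dots\ge k_r$ a *gap sequence* for $D$ and $d$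 if every finite structure $X$ (of the signature of $D$) with the following property satisfies $X\to D$: there are sets $\mathcal I_i(U)$ ($0\le i\le r$, $U\subseteq X$, $|U|\le k_i$), each consisting of at most $d$ partial homomorphisms $U\to D$, such that for all $U_0\supseteq\dots\supseteq U_r$ with $|U_i|\le k_i$ there are $i<j$ and $f\in\mathcal I_i(U_i)$ with $f|_{U_j}\in\mathcal I_j(U_j)$. **Statement.** Let $(A,A')$ and $(B,B')$ be promise templates, and suppose that for some $d$ and $r$ there is a $(d,r)$-homomorphism from $\omega(\mathrm{Pol}(B,B'))$ to $\mathrm{Pol}(A,A')$. Then $\mathrm{PCSP}(A,A')\le_{\mathrm{DL}}\mathrm{PCSP}(B,B')$. Moreover, there is a gap sequence $k_0\ge\dots\ge k_r$ for $A'$ and $d$ with $k_0\ge 1$, and for every such sequence the $k_0$-consistency reduction is a reduction from $\mathrm{PCSP}(A,A')$ to $\mathrm{PCSP}(B,B')$. -/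

import Mathlib

universe u v w

namespace PCSPReductions

/-! ## Multisorted relational structures -/

/-- An arity over a set `T` of types: a finite tuple of types. -/
structure Arity (T : Type) where
  /-- the length of the tuple -/
  len : ℕ
  /-- the entries of the tuple -/
  typ : Fin len → T

/-- The tuples of arity `α` over a `T`-indexed family of sets. -/
abbrev Tuple {T : Type} (A : T → Type u) (α : Arity T) : Type u :=
  ∀ i : Fin α.len, A (α.typ i)

/-- Component-wise application of a type-preserving map. -/
def Tuple.map {T : Type} {A : T → Type u} {B : T → Type v} (f : ∀ t, A t → B t)
    {α : Arity T} (a : Tuple A α) : Tuple B α :=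
  fun i => f (α.typ i) (a i)

/-- Transport of a tuple along an equality of arities. -/
def Tuple.cast {T : Type} {A : T → Type u} {α β : Arity T} (h : α = β) (a : Tuple A α) :
    Tuple A β :=
  h ▸ a

/-- A finite multisorted relational signature. -/
structure Sig where
  /-- the types (sorts) -/
  Ty : Type
  /-- the relational symbols -/
  Sym : Type
  finite_ty : Finite Ty
  finite_sym : Finite Sym
  /-- the arity of a relational symbol -/
  ar : Sym → Arity Ty

/-- A relational structure of signature `S` (not necessarily finite). -/
structure Str (S : Sig) where
  /-- the domains, one for each type -/
  dom : S.Ty → Type u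
  /-- the relations, one for each symbol -/
  rel : ∀ R : S.Sym, Set (Tuple dom (S.ar R))

/-- The elements of a structure: elements of different types are different. -/
abbrev Str.Elem {S : Sig} (A : Str.{u} S) : Type u := Σ t : S.Ty, A.dom t

/-- A structure is finite if all its domains are finite (signatures are finite here). -/
def Str.IsFinite {S : Sig} (A : Str.{u} S) : Prop := ∀ t, Finite (A.dom t)

/-- Homomorphisms of structures. -/
structure Hom {S : Sig} (A : Str.{u} S) (B : Str.{v} S) where
  /-- the maps, one for each type -/
  map : ∀ t, A.dom t → B.dom t
  map_rel : ∀ (R : S.Sym) (a : Tuple A.dom (S.ar R)), a ∈ A.rel R → Tuple.map map a ∈ B.rel R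

/-- `A → B`: there is a homomorphism from `A` to `B`. -/
def HomTo {S : Sig} (A : Str.{u} S) (B : Str.{v} S) : Prop := Nonempty (Hom A B)

/-- The `X`-fold power of a structure. -/
def Str.pow {S : Sig} (B : Str.{u} S) (X : Type v) : Str.{max u v} S where
  dom t := X → B.dom t
  rel R := {b | ∀ x : X, (fun i => b i x) ∈ B.rel R}

/-- A promise template `(A, A')`: a pair of structures with `A → A'`, where `A` is finite (and `A'`
may be infinite), such that the promise CSP of the template has a negative instance. -/
structure PromiseTemplate (S : Sig) where
  /-- the structure `A` defining the positive instances -/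
  yes : Str.{0} S
  /-- the structure `A'` defining the negative instances -/
  no : Str.{u} S
  finite_yes : yes.IsFinite
  homTo : HomTo yes no
  exists_negative : ∃ X : Str.{0} S, X.IsFinite ∧ ¬ HomTo X no

/-- The map `ψ` is a reduction from the promise CSP of `T` to the promise CSP of `T'`: on all
(finite) instances it is complete and sound. -/
def IsReduction {S S' : Sig} (ψ : Str.{0} S → Str.{0} S')
    (T : PromiseTemplate.{u} S) (T' : PromiseTemplate.{v} S') : Prop :=
  ∀ X : Str.{0} S, X.IsFinite →
    (HomTo X T.yes → HomTo (ψ X) T'.yes) ∧ (¬ HomTo X T.no → ¬ HomTo (ψ X) T'.no)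

/-! ## Datalog -/

/-- An atomic formula over relational symbols `Rel` of arities `ar`, in which `V t` is the set of
variables of type `t`. -/
inductive Atom {T : Type} {Rel : Type} (ar : Rel → Arity T) (V : T → Type) : Type
  /-- a relational atom `R(x₁, …, xₙ)` -/
  | rel (R : Rel) (x : Tuple V (ar R)) : Atom ar V
  /-- an equality of two variables of the same type -/
  | eq (t : T) (x y : V t) : Atom ar V

/-- Truth of an atomic formula when the symbols are interpreted by `I` and the variables by `h`. -/
def Atom.Holds {T : Type} {Rel : Type} {ar : Rel → Arity T} {V : T → Type} {A : T → Type u}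
    (I : ∀ R, Set (Tuple A (ar R))) (h : ∀ t, V t → A t) : Atom ar V → Prop
  | .rel R x => Tuple.map h x ∈ I R
  | .eq t x y => h t x = h t y

/-- The arities of the symbols of a signature together with further (IDB) symbols. -/
def extArity (S : Sig) {idb : Type} (idbAr : idb → Arity S.Ty) : S.Sym ⊕ idb → Arity S.Ty
  | .inl R => S.ar R
  | .inr P => idbAr P

/-- A Datalog rule. The rule has the variables `Fin (vars t)` of type `t`, and its head is an atom
of an IDB symbol. (Listing a variable that occurs in no atom amounts to having `x = x` in the
body.) -/
structure DatalogRule (S : Sig) {idb : Type} (idbAr : idb → Arity S.Ty) where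
  /-- the number of variables of each type -/
  vars : S.Ty → ℕ
  /-- the symbol of the head -/
  headSym : idb
  /-- the arguments of the head -/
  headArgs : Tuple (fun t => Fin (vars t)) (idbAr headSym)
  /-- the body -/
  body : List (Atom (extArity S idbAr) (fun t => Fin (vars t)))

/-- A Datalog program with input signature `S`. -/
structure DatalogProgram (S : Sig) where
  /-- the IDB symbols -/
  idb : Type
  finite_idb : Finite idb
  /-- their arities -/
  idbAr : idb → Arity S.Ty
  /-- the rules -/
  rules : List (DatalogRule S idbAr)
  /-- the output symbol -/
  out : S.Sym ⊕ idb

namespace DatalogProgram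

variable {S : Sig}

/-- The arity of a Datalog program is the arity of its output symbol. -/
def arity (P : DatalogProgram S) : Arity S.Ty := extArity S P.idbAr P.out

/-- The interpretation of all symbols given by the input structure and relations for the IDBs. -/
def interp (P : DatalogProgram S) (A : Str.{u} S)
    (I : ∀ p : P.idb, Set (Tuple A.dom (P.idbAr p))) :
    ∀ s : S.Sym ⊕ P.idb, Set (Tuple A.dom (extArity S P.idbAr s))
  | .inl R => A.rel R
  | .inr p => I p

/-- The relations `I` are closed under the rules of the program. -/
def IsClosedUnder (P : DatalogProgram S) (A : Str.{u} S)
    (I : ∀ p : P.idb, Set (Tuple A.dom (P.idbAr p))) : Prop :=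
  ∀ ρ ∈ P.rules, ∀ h : (∀ t, Fin (ρ.vars t) → A.dom t),
    (∀ a ∈ ρ.body, a.Holds (P.interp A I) h) → Tuple.map h ρ.headArgs ∈ I ρ.headSym

/-- The fixed point of the program: the least IDB relations closed under the rules. -/
def fixpoint (P : DatalogProgram S) (A : Str.{u} S) (p : P.idb) :
    Set (Tuple A.dom (P.idbAr p)) :=
  {a | ∀ I, P.IsClosedUnder A I → a ∈ I p}

/-- The output relation of the program. -/
def eval (P : DatalogProgram S) (A : Str.{u} S) : Set (Tuple A.dom P.arity) :=
  P.interp A (P.fixpoint A) P.out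

end DatalogProgram

/-- The concatenation of the arities `β (α₁), …, β (αₙ)`. -/
def Arity.concat {T T' : Type} (α : Arity T') (β : T' → Arity T) : Arity T where
  len := ∑ i, (β (α.typ i)).len
  typ p := (β (α.typ (finSigmaFinEquiv.symm p).1)).typ (finSigmaFinEquiv.symm p).2

/-- The concatenation of a tuple of tuples. -/
def Tuple.concat {T T' : Type} {A : T → Type u} {α : Arity T'} {β : T' → Arity T}
    (a : ∀ i : Fin α.len, Tuple A (β (α.typ i))) : Tuple A (α.concat β) :=
  fun p => a (finSigmaFinEquiv.symm p).1 (finSigmaFinEquiv.symm p).2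

/-- A Datalog interpretation mapping `S`-structures to `S'`-structures. -/
structure DatalogInterpretation (S S' : Sig) where
  /-- the program defining the domain of a type -/
  dom : S'.Ty → DatalogProgram S
  /-- the program defining the relation of a symbol -/
  rel : S'.Sym → DatalogProgram S
  arity_rel : ∀ R, (rel R).arity = (S'.ar R).concat (fun t => (dom t).arity)

/-- The application of a Datalog interpretation to a structure. -/
def DatalogInterpretation.apply {S S' : Sig} (φ : DatalogInterpretation S S') (A : Str.{u} S) :
    Str.{u} S' where
  dom t := {a : Tuple A.dom (φ.dom t).arity // a ∈ (φ.dom t).eval A}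
  rel R := {a | Tuple.cast (φ.arity_rel R).symm
      (Tuple.concat (β := fun t => (φ.dom t).arity) (fun i => (a i).1)) ∈ (φ.rel R).eval A}

/-! ## Union gadgets and Datalog reductions with disjoint unions -/

/-- The image of a tuple of types under a map of types. -/
def Arity.map {T T' : Type} (d : T → T') (α : Arity T) : Arity T' where
  len := α.len
  typ i := d (α.typ i)

/-- A union gadget from `S`-structures to `S'`-structures. -/
structure UnionGadget (S S' : Sig) where
  /-- the map of types -/
  d : S.Ty → S'.Ty
  /-- the map of symbols -/
  r : S.Sym → S'.Sym
  arity_r : ∀ R, (S.ar R).map d = S'.ar (r R)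

/-- The domain of type `t` of the output of a union gadget: the disjoint union of the domains of the
types that are mapped to `t`. -/
def UnionGadget.Dom {S S' : Sig} (υ : UnionGadget S S') (A : Str.{u} S) (t : S'.Ty) : Type u :=
  Σ s : {s : S.Ty // υ.d s = t}, A.dom s.1

/-- The relations of the output of a union gadget: the unions of the relations of the symbols that
are mapped to the given one. -/
inductive UnionGadget.Rel {S S' : Sig} (υ : UnionGadget S S') (A : Str.{u} S) :
    ∀ R' : S'.Sym, Tuple (υ.Dom A) (S'.ar R') → Prop
  | intro (R : S.Sym) (a : Tuple A.dom (S.ar R)) (ha : a ∈ A.rel R) :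
      UnionGadget.Rel υ A (υ.r R) (Tuple.cast (υ.arity_r R)
        (fun i : Fin ((S.ar R).map υ.d).len => (⟨⟨(S.ar R).typ i, rfl⟩, a i⟩ :
          υ.Dom A (((S.ar R).map υ.d).typ i))))

/-- The application of a union gadget to a structure. -/
def UnionGadget.apply {S S' : Sig} (υ : UnionGadget S S') (A : Str.{u} S) : Str.{u} S' where
  dom := υ.Dom A
  rel R' := {b | υ.Rel A R' b}

/-- The promise CSP of `T` reduces to the promise CSP of `T'` by a composition of a union gadget
with a Datalog interpretation. -/
def DLReduces {S S' : Sig} (T : PromiseTemplate.{u} S) (T' : PromiseTemplate.{v} S') : Prop :=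
  ∃ (Δ : Sig) (φ : DatalogInterpretation S Δ) (υ : UnionGadget Δ S'),
    IsReduction (fun X => υ.apply (φ.apply X)) T T'

/-! ## The consistency reduction -/

/-- The type-preserving maps from a set `K` of elements of `X` to `A`. -/
abbrev Assignment {S : Sig} (X : Str.{u} S) (A : Str.{v} S) (K : Finset X.Elem) : Type (max u v) :=
  ∀ x : {x : X.Elem // x ∈ K}, A.dom x.1.1

/-- Restriction of an assignment to a subset. -/
def Assignment.restrict {S : Sig} {X : Str.{u} S} {A : Str.{v} S} {K L : Finset X.Elem}
    (h : L ⊆ K) (f : Assignment X A K) : Assignment X A L :=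
  fun x => f ⟨x.1, h x.2⟩

/-- An assignment on `K` is a partial homomorphism if it preserves all the relations between
elements of `K`. -/
def IsPartialHom {S : Sig} (X : Str.{u} S) (A : Str.{v} S) {K : Finset X.Elem}
    (f : Assignment X A K) : Prop :=
  ∀ (R : S.Sym) (a : Tuple X.dom (S.ar R)), a ∈ X.rel R →
    ∀ hK : ∀ i, (⟨(S.ar R).typ i, a i⟩ : X.Elem) ∈ K,
      (fun i => f ⟨⟨(S.ar R).typ i, a i⟩, hK i⟩) ∈ A.rel R

/-- The sets of at most `k` elements of `X`. -/
abbrev SmallSet {S : Sig} (X : Str.{u} S) (k : ℕ) : Type u := {K : Finset X.Elem // K.card ≤ k}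

/-- A consistent system of sets of partial homomorphisms on the at most `k`-element sets: for
`L ⊆ K`, each `h ∈ G L` extends to some `g ∈ G K`, and each `g ∈ G K` restricts to an element of
`G L`. -/
def IsConsistentSystem {S : Sig} (k : ℕ) (X : Str.{u} S) (A : Str.{v} S)
    (G : ∀ K : SmallSet X k, Set (Assignment X A K.1)) : Prop :=
  (∀ K, ∀ f ∈ G K, IsPartialHom X A f) ∧
  ∀ (L K : SmallSet X k) (hLK : L.1 ⊆ K.1),
    (∀ h ∈ G L, ∃ g ∈ G K, Assignment.restrict hLK g = h) ∧
    (∀ g ∈ G K, Assignment.restrict hLK g ∈ G L)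

/-- The result `𝓕 K` of enforcing `k`-consistency. Starting with all partial homomorphisms and
repeatedly removing those that violate consistency leaves exactly the largest consistent system,
i.e., the union of all consistent systems. -/
def kConsistency {S : Sig} (k : ℕ) (X : Str.{u} S) (A : Str.{v} S) (K : SmallSet X k) :
    Set (Assignment X A K.1) :=
  {f | ∃ G, IsConsistentSystem k X A G ∧ f ∈ G K}

theorem isConsistentSystem_kConsistency {S : Sig} (k : ℕ) (X : Str.{u} S) (A : Str.{v} S) :
    IsConsistentSystem k X A (kConsistency k X A) := by
  refine ⟨?_, ?_⟩
  · rintro K f ⟨G, hG, hf⟩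
    exact hG.1 K f hf
  · intro L K hLK
    refine ⟨?_, ?_⟩
    · rintro h ⟨G, hG, hh⟩
      obtain ⟨g, hg, rfl⟩ := (hG.2 L K hLK).1 h hh
      exact ⟨g, ⟨G, hG, hg⟩, rfl⟩
    · rintro g ⟨G, hG, hg⟩
      exact ⟨G, hG, (hG.2 L K hLK).2 g hg⟩

/-- The restriction map `𝓕 K → 𝓕 L` for `L ⊆ K`. -/
def kConsistency.restrict {S : Sig} {k : ℕ} {X : Str.{u} S} {A : Str.{v} S} {L K : SmallSet X k}
    (hLK : L.1 ⊆ K.1) (f : kConsistency k X A K) : kConsistency k X A L :=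
  ⟨Assignment.restrict hLK f.1,
    ((isConsistentSystem_kConsistency k X A).2 L K hLK).2 f.1 f.2⟩

/-- The elements `(K; b)` of type `t` before identification: the disjoint union of the domains of
the powers of `B` with exponents `𝓕 K`. -/
abbrev ConsPre {S S' : Sig} (k : ℕ) (A : Str.{0} S) (B : Str.{0} S') (X : Str.{0} S) (t : S'.Ty) :
    Type :=
  Σ K : SmallSet X k, (B.pow (kConsistency k X A K)).dom t

/-- The pairs of elements to be identified: `(K; b ∘ ρ)` and `(L; b)` for `L ⊆ K`, where `ρ` is the
restriction map. -/
inductive ConsIdent {S S' : Sig} (k : ℕ) (A : Str.{0} S) (B : Str.{0} S') (X : Str.{0} S)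
    (t : S'.Ty) : ConsPre k A B X t → ConsPre k A B X t → Prop
  | glue (L K : SmallSet X k) (hLK : L.1 ⊆ K.1) (b : kConsistency k X A L → B.dom t) :
      ConsIdent k A B X t ⟨K, fun f => b (kConsistency.restrict hLK f)⟩ ⟨L, b⟩

/-- The output of the `k`-consistency reduction on `X`: the disjoint union of the powers of `B` with
exponents `𝓕 K`, modulo the equivalence relation generated by the identified pairs. -/
def consReduction {S S' : Sig} (k : ℕ) (A : Str.{0} S) (B : Str.{0} S') (X : Str.{0} S) :
    Str.{0} S' where
  dom t := Quot (ConsIdent k A B X t)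
  rel R := {y | ∃ (K : SmallSet X k) (b : Tuple (B.pow (kConsistency k X A K)).dom (S'.ar R)),
    b ∈ (B.pow (kConsistency k X A K)).rel R ∧ y = fun i => Quot.mk _ ⟨K, b i⟩}

/-- The promise CSP of `T` reduces to the promise CSP of `T'` by the `k`-consistency reduction. -/
def ConsReduces {S S' : Sig} (k : ℕ) (T : PromiseTemplate.{u} S) (T' : PromiseTemplate.{v} S') :
    Prop :=
  IsReduction (consReduction k T.yes T'.yes) T T'

/-! ## Minions -/

/-- An abstract minion: a functor from finite sets to sets such that exactly the empty set is mapped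
to the empty set. -/
structure Minion where
  /-- the elements of arity `X` -/
  obj : ∀ (X : Type) [Finite X], Type u
  /-- taking minors -/
  map : ∀ {X Y : Type} [Finite X] [Finite Y], (X → Y) → obj X → obj Y
  map_id : ∀ {X : Type} [Finite X] (f : obj X), map (id : X → X) f = f
  map_comp : ∀ {X Y Z : Type} [Finite X] [Finite Y] [Finite Z] (π : Y → Z) (σ : X → Y)
    (f : obj X), map π (map σ f) = map (π ∘ σ) f
  isEmpty_iff : ∀ (X : Type) [Finite X], IsEmpty (obj X) ↔ IsEmpty X

/-- The polymorphism minion of a promise template. -/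
def Pol {S : Sig} (T : PromiseTemplate.{u} S) : Minion.{u} where
  obj X _ := Hom (T.yes.pow X) T.no
  map π f :=
    { map := fun t b => f.map t (fun x => b (π x))
      map_rel := fun R b hb => f.map_rel R (fun i x => b i (π x)) (fun x => hb (π x)) }
  map_id _ := rfl
  map_comp _ _ _ := rfl
  isEmpty_iff X _ := by
    constructor
    · intro hE
      by_contra hX
      obtain ⟨x⟩ := not_isEmpty_iff.mp hX
      obtain ⟨h⟩ := T.homTo
      exact hE.false
        { map := fun t b => h.map t (b x)
          map_rel := fun R b hb => h.map_rel R (fun i => b i x) (hb x) }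
    · intro hX
      refine ⟨fun f => ?_⟩
      obtain ⟨Y, -, hY⟩ := T.exists_negative
      exact hY ⟨{ map := fun t _ => f.map t (fun x => isEmptyElim x)
                  map_rel := fun R _ _ => f.map_rel R (fun _ x => isEmptyElim x)
                    (fun x => isEmptyElim x) }⟩

/-- Two elements of `ω(M)` are equal if their sets agree and their second components agree along the
bijection of the sets. -/
theorem omega_ext (M : Minion.{u}) {X : Type} [Finite X] {Z Z' : Set X} (h : Z = Z')
    (f : M.obj Z) (f' : M.obj Z') (e : Z → Z') (he : ∀ z, (e z : X) = z) (hf : M.map e f = f') :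
    (⟨Z, f⟩ : Σ Z : Set X, M.obj Z) = ⟨Z', f'⟩ := by
  subst h
  have : e = id := funext fun z => Subtype.ext (he z)
  subst this
  rw [M.map_id] at hf
  rw [hf]

/-- The restriction `Z → π(Z)` of a map `π : X → Y` to a subset `Z` of `X`. -/
def imageRestrict {X Y : Type} (π : X → Y) (Z : Set X) : Z → (π '' Z : Set Y) :=
  fun z => ⟨π z.1, Set.mem_image_of_mem π z.2⟩

/-- The minion `ω(M)`, whose elements of arity `X` are the pairs `(Z, f)` with `Z ⊆ X` and `f` an
element of `M` of arity `Z`; the minor of `(Z, f)` along `π` is `(π(Z), f^(π|Z))`. -/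
def omega (M : Minion.{u}) : Minion.{u} where
  obj X _ := Σ Z : Set X, M.obj Z
  map π p := ⟨π '' p.1, M.map (imageRestrict π p.1) p.2⟩
  map_id := by
    rintro X _ ⟨Z, f⟩
    refine omega_ext M (Set.image_id Z) _ _ (fun z => ⟨z.1, by simpa using z.2⟩)
      (fun _ => rfl) ?_
    rw [M.map_comp]
    exact M.map_id f
  map_comp := by
    rintro X Y W _ _ _ π σ ⟨Z, f⟩
    refine omega_ext M (Set.image_image π σ Z) _ _
      (fun z => ⟨z.1, (Set.image_image π σ Z) ▸ z.2⟩) (fun _ => rfl) ?_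
    rw [M.map_comp, M.map_comp]
    rfl
  isEmpty_iff X _ := by
    rw [isEmpty_sigma]
    constructor
    · intro h
      by_contra hX
      have h1 := (M.isEmpty_iff _).mp (h Set.univ)
      obtain ⟨x⟩ := not_isEmpty_iff.mp hX
      exact h1.false ⟨x, Set.mem_univ x⟩
    · intro hX Z
      exact (M.isEmpty_iff _).mpr ⟨fun z => hX.false z.1⟩

/-- `ξ` is a `(d, r)`-homomorphism from `M` to `N`: it assigns to each element of `M` a non-empty
set of at most `d` elements of `N` of the same arity so that, for each chain of minors
`t₀, …, t_r` in `M` (with connecting maps `π i j`), there are `i < j` and elements of `ξ(t_i)` and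
`ξ(t_j)` the latter of which is the minor of the former along `π i j`. -/
structure IsDRHom (d r : ℕ) (M : Minion.{u}) (N : Minion.{v})
    (ξ : ∀ (X : Type) [Finite X], M.obj X → Set (N.obj X)) : Prop where
  nonempty : ∀ (X : Type) [Finite X] (f : M.obj X), (ξ X f).Nonempty
  card_le : ∀ (X : Type) [Finite X] (f : M.obj X), (ξ X f).encard ≤ d
  chain : ∀ (X : Fin (r + 1) → Type) [∀ i, Finite (X i)] (t : ∀ i, M.obj (X i))
    (π : ∀ i j : Fin (r + 1), i < j → X i → X j),
    (∀ (i j : Fin (r + 1)) (hij : i < j), t j = M.map (π i j hij) (t i)) →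
    (∀ (i j k : Fin (r + 1)) (hij : i < j) (hjk : j < k),
      π i k (hij.trans hjk) = π j k hjk ∘ π i j hij) →
    ∃ (i j : Fin (r + 1)) (hij : i < j), ∃ g ∈ ξ (X i) (t i), ∃ g' ∈ ξ (X j) (t j),
      g' = N.map (π i j hij) g

/-! ## Partial solution schemes -/

/-- The instance `X` of the CSP of `D` allows a consistent sequence of partial solution schemes of
arities `k 0, …, k r` and value `d`. -/
def AllowsConsistentSchemes {S : Sig} {r : ℕ} (X : Str.{u} S) (D : Str.{v} S)
    (k : Fin (r + 1) → ℕ) (d : ℕ) : Prop :=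
  ∃ I : ∀ (i : Fin (r + 1)) (U : SmallSet X (k i)), Set (Assignment X D U.1),
    (∀ i U, (I i U).encard ≤ d ∧ ∀ f ∈ I i U, IsPartialHom X D f) ∧
    ∀ (U : ∀ i, SmallSet X (k i)) (hU : ∀ i j, i ≤ j → (U j).1 ⊆ (U i).1),
      ∃ (i j : Fin (r + 1)) (hij : i < j), ∃ f ∈ I i (U i),
        Assignment.restrict (hU i j hij.le) f ∈ I j (U j)

/-- The arities `k 0 ≥ … ≥ k r` are as in the combinatorial gap theorem for the template `D` and the
value `d`: every instance that allows a consistent sequence of partial solution schemes of these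
arities and this value is solvable. -/
def IsGapSequence {S : Sig} {r : ℕ} (D : Str.{v} S) (d : ℕ) (k : Fin (r + 1) → ℕ) : Prop :=
  Antitone k ∧ ∀ X : Str.{0} S, X.IsFinite → AllowsConsistentSchemes X D k d → HomTo X D

end PCSPReductions

/-!
Gap sequences are found by induction on their length. Among the chains in the domains of all schemes
but the first, consider the tests given by those that violate consistency: the consistency of the
whole system makes the first scheme contain, for each large set `V`, boundedly many partial
homomorphisms on `V` one of which passes each test. If some bounded set is contained in no violating
chain, then adding it to all domains makes the remaining schemes consistent, which is a shorter
system. Otherwise a bounded search tree shows that few functions occur in such covers of `V`; their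
restrictions to small sets are then bounded in number and glue to a homomorphism.

Soundness of the consistency reduction: a homomorphism from its output to `B'` restricts to
polymorphisms of arity `𝓕 K` which are minors of each other along the restriction maps. Evaluating
their images under a `(d, r)`-homomorphism at the projections `f ↦ f x` yields the sets of partial
homomorphisms to `A'` required by the gap sequence.

For the Datalog reduction, consider the program of all rules with few variables which are valid in
`A`. The assignments on small sets that satisfy everything it derives form a consistent system, so
the consistency reduction maps homomorphically to the structure assembled from powers of `B` whose
exponents are the derived relations.
-/

namespace PCSPReductions

/-! ## Hitting sets and gluing -/

theorem encard_biUnion_le_mul {ι : Type*} {γ : Type*} {s : Set ι} {f : ι → Set γ} {m n : ℕ}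
    (hs : s.encard ≤ m) (hf : ∀ i ∈ s, (f i).encard ≤ n) :
    (⋃ i ∈ s, f i).encard ≤ (m * n : ℕ) := by
  lift s to Finset ι using Set.finite_of_encard_le_coe hs
  rw [Set.encard_coe_eq_coe_finsetCard, Nat.cast_le] at hs
  calc (⋃ i ∈ (s : Set ι), f i).encard ≤ ∑ i ∈ s, (f i).encard := s.set_encard_biUnion_le f
    _ ≤ s.card • (n : ℕ∞) := s.sum_le_card_nsmul _ _ hf
    _ ≤ (m * n : ℕ) := by
      rw [nsmul_eq_mul]
      exact_mod_cast Nat.mul_le_mul_right n hs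

theorem injOn_of_le_encard_image {γ δ : Type*} {s : Set γ} {f : γ → δ} {n : ℕ}
    (hs : s.encard ≤ n) (hf : n ≤ (f '' s).encard) : s.InjOn f :=
  (Set.finite_of_encard_le_coe hs).injOn_of_encard_image_eq
    ((Set.encard_image_le f s).antisymm (hs.trans hf))

section HittingSets

variable {γ : Type*} {𝒯 : Set (Set γ)} {e n : ℕ}

/-- A bounded search tree: `C` extends to a member of `𝒯` only through one of the at most `e`
elements of a set hitting `𝒯` outside `C`. -/
theorem encard_supersets_le_pow (hcard : ∀ T ∈ 𝒯, T.encard ≤ n)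
    (hhit : ∀ T ∈ 𝒯, ∀ C ⊆ T, C.encard < n →
      ∃ H : Set γ, H.encard ≤ e ∧ Disjoint H C ∧ ∀ T ∈ 𝒯, (H ∩ T).Nonempty)
    (j : ℕ) (C : Set γ) (hC : C.encard + j = n) : {T ∈ 𝒯 | C ⊆ T}.encard ≤ (e ^ j : ℕ) := by
  induction j generalizing C with
  | zero =>
    rw [Nat.cast_zero, add_zero] at hC
    refine (Set.encard_le_one_iff.mpr fun T T' hT hT' => ?_).trans_eq (by simp)
    have heq : ∀ T ∈ 𝒯, C ⊆ T → C = T := fun T hT hCT =>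
      (Set.finite_of_encard_le_coe (hcard T hT)).eq_of_subset_of_encard_le' hCT
        ((hcard T hT).trans hC.ge)
    exact (heq T hT.1 hT.2).symm.trans (heq T' hT'.1 hT'.2)
  | succ j ih =>
    obtain hempty | ⟨T₀, hT₀, hCT₀⟩ := {T ∈ 𝒯 | C ⊆ T}.eq_empty_or_nonempty
    · simp [hempty]
    have hfin : C.encard ≠ ⊤ := by rintro h; simp [h] at hC
    lift C.encard to ℕ using hfin with c hc
    obtain ⟨H, hHcard, hHC, hH⟩ := hhit T₀ hT₀ C hCT₀ (by rw [← hc, ← hC]; norm_cast; omega)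
    have hsub : {T ∈ 𝒯 | C ⊆ T} ⊆ ⋃ x ∈ H, {T ∈ 𝒯 | insert x C ⊆ T} := by
      rintro T ⟨hT, hCT⟩
      obtain ⟨x, hxH, hxT⟩ := hH T hT
      exact Set.mem_biUnion hxH ⟨hT, Set.insert_subset hxT hCT⟩
    rw [pow_succ']
    refine (Set.encard_le_encard hsub).trans (encard_biUnion_le_mul hHcard fun x hx => ih _ ?_)
    rw [Set.encard_insert_of_notMem (hHC.notMem_of_mem_left hx), ← hc, ← hC]
    norm_cast
    omega

theorem encard_sUnion_le_mul_pow (hcard : ∀ T ∈ 𝒯, T.encard ≤ n)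
    (hhit : ∀ T ∈ 𝒯, ∀ C ⊆ T, C.encard < n →
      ∃ H : Set γ, H.encard ≤ e ∧ Disjoint H C ∧ ∀ T ∈ 𝒯, (H ∩ T).Nonempty) :
    (⋃₀ 𝒯).encard ≤ (e ^ n * n : ℕ) := by
  have h𝒯 : 𝒯.encard ≤ (e ^ n : ℕ) := by
    simpa using encard_supersets_le_pow hcard hhit n ∅ (by simp)
  rw [Set.sUnion_eq_biUnion]
  exact encard_biUnion_le_mul h𝒯 hcard

end HittingSets

section PartialFunctions

open Finset (restrict₂)

variable {α : Type u} {π : α → Type v}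

/-- A family of sets of partial functions, one set for each finite domain, that is closed under
restriction. -/
def IsHereditary (𝓕 : ∀ V : Finset α, Set (∀ x : V, π x)) : Prop :=
  ∀ ⦃U V : Finset α⦄ (h : U ⊆ V), ∀ f ∈ 𝓕 V, restrict₂ h f ∈ 𝓕 U

theorem restrict₂_eq_of_restrict₂_eq {n : ℕ} {Z W V : Finset α} (hZW : Z ⊆ W) (hWV : W ⊆ V)
    {𝒢 : Set (∀ x : V, π x)} (hW : (restrict₂ hWV '' 𝒢).encard ≤ n)
    (hZ : n ≤ (restrict₂ (hZW.trans hWV) '' 𝒢).encard) {f g : ∀ x : V, π x} (hf : f ∈ 𝒢)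
    (hg : g ∈ 𝒢) (hfg : restrict₂ (hZW.trans hWV) f = restrict₂ (hZW.trans hWV) g) :
    restrict₂ hWV f = restrict₂ hWV g := by
  have hinj : Set.InjOn (restrict₂ hZW) (restrict₂ hWV '' 𝒢) :=
    injOn_of_le_encard_image hW (by rwa [Set.image_image])
  exact hinj ⟨f, hf, rfl⟩ ⟨g, hg, rfl⟩ hfg

section Gluing

variable {𝓕 : ∀ V : Finset α, Set (∀ x : V, π x)}

theorem IsHereditary.exists_restrict₂_eq (h𝓕 : IsHereditary 𝓕) {n : ℕ} {Z U V : Finset α}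
    (hZU : Z ⊆ U) (hUV : U ⊆ V) (hU : (restrict₂ hZU '' 𝓕 U).encard ≤ n)
    (hV : n ≤ (restrict₂ (hZU.trans hUV) '' 𝓕 V).encard) :
    ∀ f ∈ 𝓕 U, ∃ g ∈ 𝓕 V, restrict₂ (hZU.trans hUV) g = restrict₂ hZU f := by
  have hsub : restrict₂ (hZU.trans hUV) '' 𝓕 V ⊆ restrict₂ hZU '' 𝓕 U := by
    rintro _ ⟨g, hg, rfl⟩
    exact ⟨restrict₂ hUV g, h𝓕 hUV g hg, rfl⟩
  have heq := (Set.finite_of_encard_le_coe hU).eq_of_subset_of_encard_le' hsub (hU.trans hV)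
  intro f hf
  rw [← Set.mem_image, heq]
  exact Set.mem_image_of_mem _ hf

/-- The hypotheses make `n` the number of restrictions to `Z` of members of `𝓕 V` for all large `V`,
and each of these restrictions then has at most one further extension to any given element. -/
theorem IsHereditary.exists_forall_restrict_mem (h𝓕 : IsHereditary 𝓕) {a n t : ℕ}
    {Z : Finset α} (hn : 1 ≤ n)
    (hmany : ∀ (V : Finset α) (h : Z ⊆ V), V.card ≤ (a + 2) * t →
      n ≤ (restrict₂ h '' 𝓕 V).encard)
    (hfew : ∀ W : Finset α, Z ⊆ W → W.card ≤ Z.card + 1 →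
      ∃ (V : Finset α) (h : W ⊆ V), V.card ≤ t ∧ (restrict₂ h '' 𝓕 V).encard ≤ n) :
    ∃ F : ∀ x, π x, ∀ Y : Finset α, Y.card ≤ a → Y.restrict F ∈ 𝓕 Y := by
  classical
  obtain ⟨V₀, hZ, hV₀, hle₀⟩ := hfew Z subset_rfl (Nat.le_succ _)
  obtain ⟨_, f₀, hf₀, rfl⟩ : (restrict₂ hZ '' 𝓕 V₀).Nonempty := by
    rw [← Set.one_le_encard_iff_nonempty]
    exact (Nat.one_le_cast.mpr hn).trans (hmany V₀ hZ (by nlinarith))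
  have hext : ∀ (V : Finset α) (h : V₀ ⊆ V), V.card ≤ (a + 2) * t →
      ∃ f ∈ 𝓕 V, restrict₂ (hZ.trans h) f = restrict₂ hZ f₀ := fun V h hV =>
    h𝓕.exists_restrict₂_eq hZ h hle₀ (hmany V _ hV) f₀ hf₀
  choose v hv hvcard hvle using fun y =>
    hfew (insert y Z) (Finset.subset_insert y Z) (Finset.card_insert_le y Z)
  have hyv : ∀ y, y ∈ v y := fun y => hv y (Finset.mem_insert_self y Z)
  have hunique : ∀ y, ∀ f ∈ 𝓕 (v y), ∀ g ∈ 𝓕 (v y),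
      (restrict₂ ((Finset.subset_insert y Z).trans (hv y)) f : ∀ x : Z, π x) =
        restrict₂ ((Finset.subset_insert y Z).trans (hv y)) g → f ⟨y, hyv y⟩ = g ⟨y, hyv y⟩ :=
    fun y f hf g hg hfg => congrFun (restrict₂_eq_of_restrict₂_eq (Finset.subset_insert y Z) (hv y)
      (hvle y) (hmany _ _ ((hvcard y).trans (by nlinarith))) hf hg hfg)
      ⟨y, Finset.mem_insert_self y Z⟩
  choose g hg hgZ using fun y => hext (V₀ ∪ v y) Finset.subset_union_left
    ((Finset.card_union_le _ _).trans (by nlinarith [hvcard y]))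
  refine ⟨fun y => g y ⟨y, Finset.mem_union_right _ (hyv y)⟩, fun Y hY => ?_⟩
  have hvY : ∀ y ∈ Y, v y ⊆ V₀ ∪ Y.biUnion v := fun y hy =>
    (Finset.subset_biUnion_of_mem v hy).trans Finset.subset_union_right
  have hYV : Y ⊆ V₀ ∪ Y.biUnion v := fun y hy => hvY y hy (hyv y)
  obtain ⟨f, hf, hfZ⟩ := hext (V₀ ∪ Y.biUnion v) Finset.subset_union_left (by
    have := Finset.card_biUnion_le_card_mul Y v t fun y _ => hvcard y
    have := Nat.mul_le_mul_right t hY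
    have := Finset.card_union_le V₀ (Y.biUnion v)
    linarith)
  have heq : Y.restrict (fun y => g y ⟨y, Finset.mem_union_right _ (hyv y)⟩) = restrict₂ hYV f :=
    funext fun y => hunique y _ (h𝓕 Finset.subset_union_right _ (hg y)) _ (h𝓕 (hvY y y.2) f hf)
      ((hgZ y).trans hfZ.symm)
  exact heq ▸ h𝓕 hYV f hf

theorem IsHereditary.exists_forall_restrict_mem_of_encard_le (h𝓕 : IsHereditary 𝓕) {a b B : ℕ}
    (hne : ∀ V : Finset α, V.card ≤ (a + 2) ^ b * B → (𝓕 V).Nonempty)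
    (hb : ∀ Z : Finset α, Z.card ≤ b →
      ∃ (V : Finset α) (h : Z ⊆ V), V.card ≤ B ∧ (restrict₂ h '' 𝓕 V).encard ≤ b) :
    ∃ F : ∀ x, π x, ∀ Y : Finset α, Y.card ≤ a → Y.restrict F ∈ 𝓕 Y := by
  let Many (n : ℕ) : Prop := ∃ Z : Finset α, Z.card ≤ n ∧ ∀ (V : Finset α) (h : Z ⊆ V),
    V.card ≤ (a + 2) ^ (b - n) * B → n + 1 ≤ (restrict₂ h '' 𝓕 V).encard
  have hzero : Many 0 := ⟨∅, by simp, fun V h hV => by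
    simpa using (hne V hV).image (restrict₂ h)⟩
  have hlast : ¬ Many b := fun ⟨Z, hZ, hmany⟩ => by
    obtain ⟨V, h, hV, hle⟩ := hb Z hZ
    have := (hmany V h (by simpa using hV)).trans hle
    norm_cast at this
    omega
  obtain ⟨n, hnb, ⟨Z, hZ, hmany⟩, hnot⟩ : ∃ n < b, Many n ∧ ¬ Many (n + 1) := by
    by_contra! hsucc
    exact hlast (Nat.le_induction (m := 0) (P := fun n _ => n ≤ b → Many n) (fun _ => hzero)
      (fun n _ ih hn => hsucc n hn (ih (by omega))) b (Nat.zero_le b) le_rfl)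
  refine h𝓕.exists_forall_restrict_mem (n := n + 1) (t := (a + 2) ^ (b - (n + 1)) * B)
    (Z := Z) (Nat.le_add_left 1 n) (fun V h hV => ?_) fun W _ hWcard => ?_
  · refine mod_cast hmany V h (hV.trans_eq ?_)
    rw [← mul_assoc, ← pow_succ', show b - (n + 1) + 1 = b - n by omega]
  · by_contra! hmore
    refine hnot ⟨W, hWcard.trans (by omega), fun V h hV => ?_⟩
    exact Order.add_one_le_of_lt (hmore V h hV)

end Gluing

/-! ## Covers of local tests -/

section Stages

variable [DecidableEq α] {u : Finset α → Finset α}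

/-- The set reached from `∅` in `i` rounds of adding the sets `u W` for all subsets `W` of the
current set. -/
def stage (u : Finset α → Finset α) : ℕ → Finset α
  | 0 => ∅
  | i + 1 => (stage u i).powerset.biUnion u

theorem subset_stage_succ {W : Finset α} {i : ℕ} (hW : W ⊆ stage u i) : u W ⊆ stage u (i + 1) :=
  Finset.subset_biUnion_of_mem u (Finset.mem_powerset.mpr hW)

theorem monotone_stage (hu : ∀ W, W ⊆ u W) : Monotone (stage u) :=
  monotone_nat_of_le_succ fun _ => (hu _).trans (subset_stage_succ subset_rfl)

/-- A bound on the size of `stage u i` when `u` adds at most `K` elements to each set. -/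
def stageBound (K : ℕ) : ℕ → ℕ
  | 0 => 0
  | i + 1 => 2 ^ stageBound K i * (stageBound K i + K)

theorem card_stage_le {K : ℕ} (hu : ∀ W, (u W).card ≤ W.card + K) (i : ℕ) :
    (stage u i).card ≤ stageBound K i := by
  induction i with
  | zero => exact le_rfl
  | succ i ih =>
    refine (Finset.card_biUnion_le_card_mul _ _ (stageBound K i + K) fun W hW => ?_).trans
      (Nat.mul_le_mul_right _ ?_)
    · exact (hu W).trans (Nat.add_le_add_right
        ((Finset.card_le_card (Finset.mem_powerset.mp hW)).trans ih) K)
    · rw [Finset.card_powerset]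
      exact Nat.pow_le_pow_right two_pos ih

theorem exists_lt_encard_image_insert {W U V : Finset α} (hWU : W ⊆ U) (hUV : U ⊆ V)
    {𝒢 : Set (∀ x : V, π x)} (h : ¬ Set.InjOn (restrict₂ hWU) (restrict₂ (π := π) hUV '' 𝒢)) {n : ℕ}
    (hn : n ≤ (restrict₂ (hWU.trans hUV) '' 𝒢).encard) :
    ∃ (x : α) (hx : x ∈ U),
      n < (restrict₂ (Finset.insert_subset (hUV hx) (hWU.trans hUV)) '' 𝒢).encard := by
  simp only [Set.InjOn, not_forall] at h
  obtain ⟨_, ⟨f, hf, rfl⟩, _, ⟨g, hg, rfl⟩, hfgW, hfg⟩ := h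
  obtain ⟨⟨x, hx⟩, hne⟩ := Function.ne_iff.mp hfg
  refine ⟨x, hx, not_le.mp fun hle => hne ?_⟩
  exact congrFun (restrict₂_eq_of_restrict₂_eq (Finset.subset_insert x W) _ hle hn hf hg hfgW)
    ⟨x, Finset.mem_insert_self x W⟩

theorem exists_injOn_restrict₂ (hu : ∀ W, W ⊆ u W) {M : ℕ} {V : Finset α}
    (hV : stage u (M + 1) ⊆ V) {𝒢 : Set (∀ x : V, π x)} (h𝒢 : 𝒢.encard ≤ M) :
    ∃ (W : Finset α) (h : u W ⊆ V), W.card ≤ M ∧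
      Set.InjOn (restrict₂ (hu W)) (restrict₂ (π := π) h '' 𝒢) := by
  by_contra! hnot
  have hmany : ∀ i ≤ M + 1, ∃ (W : Finset α) (h : W ⊆ V), W ⊆ stage u i ∧ W.card ≤ i ∧
      i ≤ (restrict₂ (π := π) h '' 𝒢).encard := by
    intro i
    induction i with
    | zero => exact fun _ => ⟨∅, Finset.empty_subset V, by simp⟩
    | succ i ih =>
      intro hi
      obtain ⟨W, hWV, hWi, hWcard, hle⟩ := ih (by omega)
      have huV : u W ⊆ V := (subset_stage_succ hWi).trans ((monotone_stage hu hi).trans hV)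
      obtain ⟨x, hx, hlt⟩ :=
        exists_lt_encard_image_insert (hu W) huV (hnot W huV (by omega)) hle
      exact ⟨insert x W, _, Finset.insert_subset (subset_stage_succ hWi hx)
        (hWi.trans (monotone_stage hu i.le_succ)), (Finset.card_insert_le x W).trans (by omega),
        Order.add_one_le_of_lt hlt⟩
  obtain ⟨W, h, -, -, hle⟩ := hmany (M + 1) le_rfl
  have := (hle.trans (Set.encard_image_le _ _)).trans h𝒢
  norm_cast at this
  omega

end Stages

/-- A test applies to the partial functions that are defined on `supp`; which of them pass is given
by `pass`. The subset `base` of the support serves to bound the number of restrictions of passing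
functions. -/
structure LocalTest (π : α → Type v) where
  base : Finset α
  supp : Finset α
  base_subset : base ⊆ supp
  pass : Set (∀ x : supp, π x)

/-- A `p`-cover of `V`: a set of at most `p` functions in `P V` such that each test with support in
`V` is passed by one of them. -/
structure IsCover (P : ∀ V : Finset α, Set (∀ x : V, π x)) (𝓠 : Set (LocalTest π)) (p : ℕ)
    (V : Finset α) (T : Set (∀ x : V, π x)) : Prop where
  encard_le : T.encard ≤ p
  subset : T ⊆ P V
  exists_pass : ∀ q ∈ 𝓠, ∀ h : q.supp ⊆ V, ∃ f ∈ T, restrict₂ h f ∈ q.pass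

/-- The functions that occur in some `p`-cover of `V`. -/
def coverFuns (P : ∀ V : Finset α, Set (∀ x : V, π x)) (𝓠 : Set (LocalTest π)) (p : ℕ)
    (V : Finset α) : Set (∀ x : V, π x) :=
  ⋃₀ {T | IsCover P 𝓠 p V T}

section Covers

variable {P : ∀ V : Finset α, Set (∀ x : V, π x)} {𝓠 : Set (LocalTest π)} {p e : ℕ}

theorem IsCover.restrict (hP : IsHereditary P) {U V : Finset α} (h : U ⊆ V)
    {T : Set (∀ x : V, π x)} (hT : IsCover P 𝓠 p V T) : IsCover P 𝓠 p U (restrict₂ h '' T) where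
  encard_le := (Set.encard_image_le _ _).trans hT.encard_le
  subset := by
    rintro _ ⟨f, hf, rfl⟩
    exact hP h f (hT.subset hf)
  exists_pass q hq hU := by
    obtain ⟨f, hf, hpass⟩ := hT.exists_pass q hq (hU.trans h)
    exact ⟨_, ⟨f, hf, rfl⟩, hpass⟩

theorem isHereditary_coverFuns (hP : IsHereditary P) : IsHereditary (coverFuns P 𝓠 p) :=
  fun _ _ h f ⟨_, hT, hf⟩ => ⟨_, hT.restrict hP h, f, hf, rfl⟩

theorem coverFuns_subset (V : Finset α) : coverFuns P 𝓠 p V ⊆ P V :=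
  fun _ ⟨_, hT, hf⟩ => hT.subset hf

theorem nonempty_coverFuns (hP : IsHereditary P) {q : LocalTest π} (hq : q ∈ 𝓠) {V U : Finset α}
    (hV : V ⊆ U) (hU : q.supp ⊆ U) {T : Set (∀ x : U, π x)} (hT : IsCover P 𝓠 p U T) :
    (coverFuns P 𝓠 p V).Nonempty := by
  obtain ⟨f, hf, -⟩ := hT.exists_pass q hq hU
  exact ⟨_, isHereditary_coverFuns hP hV f ⟨T, hT, hf⟩⟩

theorem exists_hitting_set (h𝓠 : ∀ q ∈ 𝓠, (restrict₂ q.base_subset '' q.pass).encard ≤ e)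
    {W U : Finset α} (hWU : W ⊆ U)
    (hno : ∀ T, ¬ IsCover P {q ∈ 𝓠 | W ⊆ q.base} p U T) {n : ℕ} {𝒯 : Set (Set (∀ x : U, π x))}
    (h𝒯 : ∀ T ∈ 𝒯, IsCover P 𝓠 n U T) (hinj : Set.InjOn (restrict₂ hWU) (⋃₀ 𝒯))
    {C : Set (∀ x : U, π x)} (hCP : C ⊆ P U) (hC : C.encard ≤ p) :
    ∃ H : Set (∀ x : U, π x), H.encard ≤ e ∧ Disjoint H C ∧ ∀ T ∈ 𝒯, (H ∩ T).Nonempty := by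
  obtain ⟨q, hq, hWq, hqU, hfail⟩ : ∃ q ∈ 𝓠, W ⊆ q.base ∧ ∃ h : q.supp ⊆ U,
      ∀ f ∈ C, restrict₂ h f ∉ q.pass := by
    by_contra! hpass
    exact hno C ⟨hC, hCP, fun q hq h => hpass q hq.1 hq.2 h⟩
  let H := {f ∈ ⋃₀ 𝒯 | restrict₂ hqU f ∈ q.pass}
  refine ⟨H, ?_, ?_, ?_⟩
  · have hbase : Set.InjOn (restrict₂ (q.base_subset.trans hqU)) H := fun f hf g hg hfg =>
      hinj hf.1 hg.1 (congrArg (restrict₂ hWq) hfg)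
    rw [← hbase.encard_image]
    refine (Set.encard_le_encard ?_).trans (h𝓠 q hq)
    rintro _ ⟨f, hf, rfl⟩
    exact ⟨_, hf.2, rfl⟩
  · exact Set.disjoint_left.mpr fun f hf hfC => hfail f hfC hf.2
  · intro T hT
    obtain ⟨f, hf, hpass⟩ := (h𝒯 T hT).exists_pass q hq hqU
    exact ⟨f, ⟨⟨T, hT, hf⟩, hpass⟩, hf⟩

theorem encard_sUnion_covers_le
    (h𝓠 : ∀ q ∈ 𝓠, (restrict₂ q.base_subset '' q.pass).encard ≤ e) {W U : Finset α} (hWU : W ⊆ U)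
    (hno : ∀ T, ¬ IsCover P {q ∈ 𝓠 | W ⊆ q.base} p U T) {𝒯 : Set (Set (∀ x : U, π x))}
    (h𝒯 : ∀ T ∈ 𝒯, IsCover P 𝓠 (p + 1) U T) (hinj : Set.InjOn (restrict₂ hWU) (⋃₀ 𝒯)) :
    (⋃₀ 𝒯).encard ≤ (e ^ (p + 1) * (p + 1) : ℕ) :=
  encard_sUnion_le_mul_pow (fun T hT => (h𝒯 T hT).encard_le) fun T hT _ hCT hC =>
    exists_hitting_set h𝓠 hWU hno h𝒯 hinj (hCT.trans (h𝒯 T hT).subset) (Order.le_of_lt_add_one hC)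

theorem encard_coverFuns_le [DecidableEq α] (hP : IsHereditary P)
    (h𝓠 : ∀ q ∈ 𝓠, (restrict₂ q.base_subset '' q.pass).encard ≤ e) {b : ℕ}
    (hb : b = e ^ (p + 1) * (p + 1)) {u : Finset α → Finset α} (hu : ∀ W, W ⊆ u W)
    {Z V : Finset α} (hZu : ∀ W, Z ⊆ u W)
    (hno : ∀ W : Finset α, W.card ≤ (b + 1) * (p + 1) →
      ∀ T, ¬ IsCover P {q ∈ 𝓠 | W ⊆ q.base} p (u W) T)
    (hV : stage u ((b + 1) * (p + 1) + 1) ⊆ V) (hZV : Z ⊆ V) :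
    (restrict₂ hZV '' coverFuns P 𝓠 (p + 1) V).encard ≤ b := by
  by_contra! hlt
  obtain ⟨𝒲, h𝒲, h𝒲card⟩ := Set.exists_subset_encard_eq (Order.add_one_le_of_lt hlt)
  have hcover : ∀ w ∈ 𝒲, ∃ T, IsCover P 𝓠 (p + 1) V T ∧ w ∈ restrict₂ hZV '' T := fun w hw => by
    obtain ⟨f, ⟨T, hT, hf⟩, rfl⟩ := h𝒲 hw
    exact ⟨T, hT, f, hf, rfl⟩
  choose! T hT hw using hcover
  obtain ⟨W, hV', hW, hinj⟩ := exists_injOn_restrict₂ hu hV (𝒢 := ⋃ w ∈ 𝒲, T w)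
    (encard_biUnion_le_mul (m := b + 1) (by simp [h𝒲card]) fun w hw => (hT w hw).encard_le)
  let 𝒯 := (fun w => restrict₂ hV' '' T w) '' 𝒲
  have h𝒯 : ⋃₀ 𝒯 = restrict₂ hV' '' ⋃ w ∈ 𝒲, T w := by
    rw [Set.sUnion_image, Set.image_iUnion₂]
  have hle : (⋃₀ 𝒯).encard ≤ b := by
    rw [hb]
    refine encard_sUnion_covers_le h𝓠 (hu W) (hno W hW) ?_ (h𝒯 ▸ hinj)
    rintro _ ⟨w, hw𝒲, rfl⟩
    exact (hT w hw𝒲).restrict hP hV'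
  have hsub : 𝒲 ⊆ restrict₂ (hZu W) '' ⋃₀ 𝒯 := by
    intro w hw𝒲
    obtain ⟨f, hf, hfw⟩ := hw w hw𝒲
    exact ⟨restrict₂ hV' f, ⟨_, ⟨w, hw𝒲, rfl⟩, f, hf, rfl⟩, hfw⟩
  have := ((Set.encard_le_encard hsub).trans (Set.encard_image_le _ _)).trans hle
  rw [h𝒲card] at this
  norm_cast at this
  omega

theorem exists_forall_restrict_mem_of_not_isCover (hP : IsHereditary P)
    (h𝓠 : ∀ q ∈ 𝓠, (restrict₂ q.base_subset '' q.pass).encard ≤ e) {a b K : ℕ}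
    (hb : b = e ^ (p + 1) * (p + 1))
    (hno : ∀ W : Finset α, W.card ≤ (b + 1) * (p + 1) →
      ∃ V : Finset α, V.card ≤ K ∧ ∀ T, ¬ IsCover P {q ∈ 𝓠 | W ⊆ q.base} p V T)
    (hne : ∀ V : Finset α,
      V.card ≤ (a + 2) ^ b * (stageBound (K + b) ((b + 1) * (p + 1) + 1) + b) →
      (coverFuns P 𝓠 (p + 1) V).Nonempty) :
    ∃ F : ∀ x, π x, ∀ Y : Finset α, Y.card ≤ a → Y.restrict F ∈ P Y := by
  classical
  have hv : ∀ W : Finset α, ∃ V : Finset α, V.card ≤ K ∧ (W.card ≤ (b + 1) * (p + 1) →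
      ∀ T, ¬ IsCover P {q ∈ 𝓠 | W ⊆ q.base} p V T) := fun W => by
    by_cases hW : W.card ≤ (b + 1) * (p + 1)
    · obtain ⟨V, hV, hVno⟩ := hno W hW
      exact ⟨V, hV, fun _ => hVno⟩
    · exact ⟨∅, Nat.zero_le K, fun h => absurd h hW⟩
  choose v hvcard hv using hv
  obtain ⟨F, hF⟩ := (isHereditary_coverFuns hP).exists_forall_restrict_mem_of_encard_le hne
    fun Z hZ => by
      let u W := W ∪ (v W ∪ Z)
      have hu : ∀ W, (u W).card ≤ W.card + (K + b) := fun W =>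
        (Finset.card_union_le _ _).trans (Nat.add_le_add_left
          ((Finset.card_union_le _ _).trans (Nat.add_le_add (hvcard W) hZ)) _)
      refine ⟨stage u ((b + 1) * (p + 1) + 1) ∪ Z, Finset.subset_union_right,
        (Finset.card_union_le _ _).trans (Nat.add_le_add (card_stage_le hu _) hZ),
        encard_coverFuns_le hP h𝓠 hb (u := u) (fun W => Finset.subset_union_left)
          (fun W => Finset.subset_union_right.trans Finset.subset_union_right)
          (fun W hW T hT => hv W hW _ (hT.restrict hP
            (Finset.subset_union_left.trans Finset.subset_union_right)))
          Finset.subset_union_left _⟩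
  exact ⟨F, fun Y hY => coverFuns_subset Y (hF Y hY)⟩

end Covers

end PartialFunctions

theorem exists_forall_restrict_mem_or_no_tests (a e p : ℕ) :
    ∃ z : ℕ, ∀ m : ℕ, ∃ K : ℕ, ∀ {α : Type u} {π : α → Type v}
      {P : ∀ V : Finset α, Set (∀ x : V, π x)} {𝓠 : Set (LocalTest π)}, IsHereditary P →
      (∀ q ∈ 𝓠, q.supp.card ≤ m ∧ (Finset.restrict₂ q.base_subset '' q.pass).encard ≤ e) →
      (∀ V : Finset α, V.card ≤ K → ∃ T, IsCover P 𝓠 p V T) →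
      (∃ F : ∀ x, π x, ∀ Y : Finset α, Y.card ≤ a → Y.restrict F ∈ P Y) ∨
        ∃ Z : Finset α, Z.card ≤ z ∧ ∀ q ∈ 𝓠, ¬ Z ⊆ q.base := by
  induction p with
  | zero =>
    refine ⟨0, fun m => ⟨m, fun _ h𝓠 hcov => Or.inr ⟨∅, le_rfl, fun q hq _ => ?_⟩⟩⟩
    obtain ⟨T, hT⟩ := hcov q.supp (h𝓠 q hq).1
    obtain ⟨f, hf, -⟩ := hT.exists_pass q hq subset_rfl
    exact (Set.encard_eq_zero.mp (nonpos_iff_eq_zero.mp hT.encard_le) ▸ hf :)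
  | succ p ih =>
    obtain ⟨z, hz⟩ := ih
    let b := e ^ (p + 1) * (p + 1)
    refine ⟨(b + 1) * (p + 1) + z, fun m => ?_⟩
    obtain ⟨K, hK⟩ := hz m
    refine ⟨(a + 2) ^ b * (stageBound (K + b) ((b + 1) * (p + 1) + 1) + b) + m,
      fun {α π P 𝓠} hP h𝓠 hcov => ?_⟩
    classical
    by_cases hW : ∃ W : Finset α, W.card ≤ (b + 1) * (p + 1) ∧
      ∀ V : Finset α, V.card ≤ K → ∃ T, IsCover P {q ∈ 𝓠 | W ⊆ q.base} p V T
    · obtain ⟨W, hWcard, hWcov⟩ := hW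
      refine (hK hP (fun q hq => h𝓠 q hq.1) hWcov).imp_right fun ⟨Z, hZ, hno⟩ => ?_
      exact ⟨W ∪ Z, (Finset.card_union_le _ _).trans (Nat.add_le_add hWcard hZ), fun q hq h =>
        hno q ⟨hq, Finset.subset_union_left.trans h⟩ (Finset.subset_union_right.trans h)⟩
    push Not at hW
    obtain rfl | ⟨q, hq⟩ := 𝓠.eq_empty_or_nonempty
    · exact Or.inr ⟨∅, Nat.zero_le _, by simp⟩
    refine Or.inl (exists_forall_restrict_mem_of_not_isCover hP (fun q hq => (h𝓠 q hq).2) rfl hW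
      fun V hV => ?_)
    obtain ⟨T, hT⟩ := hcov (V ∪ q.supp)
      ((Finset.card_union_le _ _).trans (Nat.add_le_add hV (h𝓠 q hq).1))
    exact nonempty_coverFuns hP hq Finset.subset_union_left Finset.subset_union_right hT

/-! ## Gap sequences -/

section Gap

variable {S : Sig} {X : Str.{v} S} {D : Str.{u} S}

theorem isHereditary_isPartialHom :
    IsHereditary (π := fun x : X.Elem => D.dom x.1) fun _ => {f | IsPartialHom X D f} :=
  fun _ _ h _ hf R a ha hL => hf R a ha fun i => h (hL i)

theorem homTo_of_forall_isPartialHom {a : ℕ} (ha : ∀ R, (S.ar R).len ≤ a)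
    (F : ∀ x : X.Elem, D.dom x.1)
    (hF : ∀ K : Finset X.Elem, K.card ≤ a → IsPartialHom X D (K.restrict F)) : HomTo X D := by
  classical
  refine ⟨⟨fun t x => F ⟨t, x⟩, fun R b hb => ?_⟩⟩
  exact hF (Finset.univ.image fun i => ⟨(S.ar R).typ i, b i⟩)
    (Finset.card_image_le.trans (by simpa using ha R)) R b hb
    fun i => Finset.mem_image_of_mem _ (Finset.mem_univ i)

variable {r : ℕ} {k : Fin (r + 2) → ℕ}
  (I : ∀ (i : Fin (r + 2)) (U : SmallSet X (k i)), Set (Assignment X D U.1))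

/-- The test given by a chain `U 0 ⊇ … ⊇ U r`: a function on `U 0` passes if its restriction to
some `U j` belongs to the scheme for `U j`. The indices of the schemes are shifted by one, since the
scheme of index `0` serves to define covers. -/
def chainTest (U : ∀ i : Fin (r + 1), SmallSet X (k i.succ))
    (hU : ∀ i j, i ≤ j → (U j).1 ⊆ (U i).1) : LocalTest fun x : X.Elem => D.dom x.1 where
  base := (U (Fin.last r)).1
  supp := (U 0).1
  base_subset := hU _ _ (Fin.zero_le _)
  pass := {f | ∃ j, Assignment.restrict (hU 0 j (Fin.zero_le j)) f ∈ I j.succ (U j)}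

/-- The tests given by the chains that do not witness the consistency of the schemes other than the
first one. -/
def chainTests : Set (LocalTest fun x : X.Elem => D.dom x.1) :=
  {q | ∃ (U : ∀ i : Fin (r + 1), SmallSet X (k i.succ)) (hU : ∀ i j, i ≤ j → (U j).1 ⊆ (U i).1),
    (∀ (i j : Fin (r + 1)) (hij : i < j), ∀ f ∈ I i.succ (U i),
      Assignment.restrict (hU i j hij.le) f ∉ I j.succ (U j)) ∧ q = chainTest I U hU}

variable {I}

theorem encard_restrict_pass_chainTest_le {d : ℕ} (hI : ∀ i U, (I i U).encard ≤ d)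
    (U : ∀ i : Fin (r + 1), SmallSet X (k i.succ)) (hU : ∀ i j, i ≤ j → (U j).1 ⊆ (U i).1) :
    (Assignment.restrict (chainTest I U hU).base_subset '' (chainTest I U hU).pass).encard ≤
      ((r + 1) * d : ℕ) := by
  have hsub : Assignment.restrict (chainTest I U hU).base_subset '' (chainTest I U hU).pass ⊆
      ⋃ j ∈ Set.univ,
        Assignment.restrict (hU j (Fin.last r) (Fin.le_last j)) '' I j.succ (U j) := by
    rintro _ ⟨f, ⟨j, hf⟩, rfl⟩
    exact Set.mem_biUnion (Set.mem_univ j) ⟨_, hf, rfl⟩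
  exact (Set.encard_le_encard hsub).trans (encard_biUnion_le_mul (by simp)
    fun j _ => (Set.encard_image_le _ _).trans (hI _ _))

theorem subset_of_le_cons {V : SmallSet X (k 0)} {U : ∀ i : Fin (r + 1), SmallSet X (k i.succ)}
    (hU : ∀ i j, i ≤ j → (U j).1 ⊆ (U i).1) (hUV : (U 0).1 ⊆ V.1) (i j : Fin (r + 2))
    (hij : i ≤ j) : (Fin.cons (α := fun i => SmallSet X (k i)) V U j).1 ⊆
      (Fin.cons (α := fun i => SmallSet X (k i)) V U i).1 := by
  induction j using Fin.cases with
  | zero => rw [Fin.le_zero_iff.mp hij]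
  | succ j =>
    induction i using Fin.cases with
    | zero => exact (hU 0 j (Fin.zero_le _)).trans hUV
    | succ i => exact hU i j (Fin.succ_le_succ_iff.mp hij)

theorem isCover_chainTests {d : ℕ}
    (hI : ∀ i U, (I i U).encard ≤ d ∧ ∀ f ∈ I i U, IsPartialHom X D f)
    (hcons : ∀ (U : ∀ i, SmallSet X (k i)) (hU : ∀ i j, i ≤ j → (U j).1 ⊆ (U i).1),
      ∃ (i j : Fin (r + 2)) (hij : i < j), ∃ f ∈ I i (U i),
        Assignment.restrict (hU i j hij.le) f ∈ I j (U j))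
    (V : SmallSet X (k 0)) :
    IsCover (fun _ => {f | IsPartialHom X D f}) (chainTests I) d V.1
      (I 0 V) where
  encard_le := (hI 0 V).1
  subset := (hI 0 V).2
  exists_pass := by
    rintro _ ⟨U, hU, hbad, rfl⟩ hUV
    obtain ⟨i, j, hij, f, hf, hfj⟩ := hcons (Fin.cons V U) (subset_of_le_cons hU hUV)
    induction j using Fin.cases with
    | zero => exact absurd hij (Fin.not_lt_zero i)
    | succ j =>
      induction i using Fin.cases with
      | zero => exact ⟨f, hf, j, hfj⟩
      | succ i => exact absurd hfj (hbad i j (Fin.succ_lt_succ_iff.mp hij) f hf)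

theorem allowsConsistentSchemes_of_no_chainTests {d z : ℕ}
    (hI : ∀ i U, (I i U).encard ≤ d ∧ ∀ f ∈ I i U, IsPartialHom X D f)
    {Z : Finset X.Elem} (hZ : Z.card ≤ z) (hno : ∀ q ∈ chainTests I, ¬ Z ⊆ q.base)
    {k' : Fin (r + 1) → ℕ} (hk : ∀ i, k' i + z ≤ k i.succ) :
    AllowsConsistentSchemes X D k' d := by
  classical
  let E : ∀ i, SmallSet X (k' i) → SmallSet X (k i.succ) := fun i U =>
    ⟨U.1 ∪ Z, (Finset.card_union_le _ _).trans ((Nat.add_le_add U.2 hZ).trans (hk i))⟩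
  refine ⟨fun i U => Assignment.restrict (K := (E i U).1) Finset.subset_union_left ''
    I i.succ (E i U), fun i U => ⟨?_, ?_⟩, fun U hU => ?_⟩
  · exact (Set.encard_image_le _ _).trans (hI _ _).1
  · rintro _ ⟨f, hf, rfl⟩
    exact isHereditary_isPartialHom Finset.subset_union_left f ((hI _ _).2 f hf)
  · have hEU : ∀ i j, i ≤ j → (E j (U j)).1 ⊆ (E i (U i)).1 :=
      fun i j hij => Finset.union_subset_union_left (hU i j hij)
    by_contra! hcon
    refine hno _ ⟨fun i => E i (U i), hEU, fun i j hij f hf hfj => ?_, rfl⟩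
      Finset.subset_union_right
    exact hcon i j hij _ ⟨f, hf, rfl⟩ ⟨_, hfj, rfl⟩

end Gap

theorem antitone_cons_add {r : ℕ} {k : Fin (r + 1) → ℕ} (hk : Antitone k) {K z : ℕ}
    (hK : k 0 + z ≤ K) : Antitone (Fin.cons K fun i => k i + z : Fin (r + 2) → ℕ) := by
  rw [Fin.antitone_iff_succ_le]
  intro i
  induction i using Fin.cases with
  | zero => simpa using hK
  | succ i =>
    rw [← Fin.succ_castSucc, Fin.cons_succ, Fin.cons_succ]
    exact Nat.add_le_add_right (hk i.castSucc_le_succ) z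

theorem exists_antitone_forall_homTo {S : Sig} (D : Str.{u} S) (d r : ℕ) :
    ∃ k : Fin (r + 1) → ℕ, Antitone k ∧ 1 ≤ k 0 ∧
      ∀ X : Str.{v} S, AllowsConsistentSchemes X D k d → HomTo X D := by
  obtain ⟨a, ha⟩ : ∃ a : ℕ, ∀ R, (S.ar R).len ≤ a := by
    have := S.finite_sym
    obtain ⟨a, ha⟩ := (Set.finite_range fun R => (S.ar R).len).bddAbove
    exact ⟨a, fun R => ha (Set.mem_range_self R)⟩
  induction r with
  | zero =>
    refine ⟨fun _ => 1, antitone_const, le_rfl, fun X ⟨I, _, hI⟩ => ?_⟩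
    obtain ⟨i, j, hij, -⟩ := hI (fun _ => ⟨∅, Nat.zero_le 1⟩) (fun _ _ _ => subset_rfl)
    omega
  | succ r ih =>
    obtain ⟨k, hk, hk₀, ih⟩ := ih
    obtain ⟨z, hz⟩ := exists_forall_restrict_mem_or_no_tests.{v, u} a ((r + 1) * d) d
    obtain ⟨K, hK⟩ := hz (k 0 + z)
    refine ⟨Fin.cons (max K (k 0 + z)) fun i => k i + z,
      antitone_cons_add hk (le_max_right _ _),
      (hk₀.trans (Nat.le_add_right _ z)).trans (le_max_right _ _), fun X ⟨I, hI, hIc⟩ => ?_⟩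
    rcases hK (isHereditary_isPartialHom (X := X) (D := D)) (𝓠 := chainTests I) (by
      rintro _ ⟨U, hU, -, rfl⟩
      exact ⟨(U 0).2, encard_restrict_pass_chainTest_le (fun i U => (hI i U).1) U hU⟩)
      (fun V hV => ⟨_, isCover_chainTests hI hIc ⟨V, hV.trans (le_max_left _ _)⟩⟩)
      with ⟨F, hF⟩ | ⟨Z, hZ, hno⟩
    · exact homTo_of_forall_isPartialHom ha F hF
    · exact ih X (allowsConsistentSchemes_of_no_chainTests hI hZ hno fun i => le_rfl)

theorem exists_isGapSequence {S : Sig} (D : Str.{u} S) (d r : ℕ) :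
    ∃ k : Fin (r + 1) → ℕ, IsGapSequence D d k ∧ 1 ≤ k 0 := by
  obtain ⟨k, hk, hk₀, h⟩ := exists_antitone_forall_homTo D d r
  exact ⟨k, ⟨hk, fun X _ => h X⟩, hk₀⟩

/-! ## Soundness of the consistency reduction -/

section ConsReduction

variable {S S' : Sig}

theorem Hom.ext_map {A : Str.{u} S} {B : Str.{v} S} {f g : Hom A B}
    (h : ∀ t x, f.map t x = g.map t x) : f = g := by
  obtain ⟨f, hf⟩ := f
  obtain ⟨g, hg⟩ := g
  obtain rfl : f = g := funext₂ h
  rfl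

/-- The restriction of a homomorphism to a finite set, as an assignment. -/
def Hom.assignment {X : Str.{u} S} {A : Str.{v} S} (h : Hom X A) (K : Finset X.Elem) :
    Assignment X A K :=
  fun x => h.map x.1.1 x.1.2

theorem Hom.assignment_mem_kConsistency {X : Str.{u} S} {A : Str.{v} S} (h : Hom X A) (k : ℕ)
    (K : SmallSet X k) : h.assignment K.1 ∈ kConsistency k X A K := by
  refine ⟨fun K => {h.assignment K.1}, ⟨?_, fun L K hLK => ⟨?_, ?_⟩⟩, rfl⟩
  · rintro K _ rfl R a ha _
    exact h.map_rel R a ha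
  · rintro _ rfl
    exact ⟨_, rfl, rfl⟩
  · rintro _ rfl
    rfl

variable {X : Str.{0} S} {A : Str.{0} S} {B : Str.{0} S'} {k : ℕ}

/-- A homomorphism `X → A` is an element of every `𝓕 K`, and evaluation at it is compatible with the
identifications. -/
theorem HomTo.consReduction (B : Str.{0} S') (k : ℕ) (h : HomTo X A) :
    HomTo (consReduction k A B X) B := by
  obtain ⟨h⟩ := h
  refine ⟨⟨fun t => Quot.lift
    (fun y => y.2 ⟨h.assignment y.1.1, h.assignment_mem_kConsistency k y.1⟩) ?_, ?_⟩⟩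
  · rintro _ _ ⟨L, K, hLK, b⟩
    rfl
  · rintro R _ ⟨K, b, hb, rfl⟩
    exact hb ⟨h.assignment K.1, h.assignment_mem_kConsistency k K⟩

theorem finite_kConsistency (hA : A.IsFinite) (K : SmallSet X k) :
    Finite (kConsistency k X A K) := by
  have : ∀ x : {x : X.Elem // x ∈ K.1}, Finite (A.dom x.1.1) := fun x => hA x.1.1
  infer_instance

theorem kConsistency.restrict_surjective {L K : SmallSet X k} (hLK : L.1 ⊆ K.1) :
    Function.Surjective (kConsistency.restrict (A := A) hLK) := by
  rintro ⟨f, hf⟩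
  obtain ⟨g, hg, rfl⟩ := ((isConsistentSystem_kConsistency k X A).2 L K hLK).1 f hf
  exact ⟨⟨g, hg⟩, rfl⟩

/-- The composition of a homomorphism from the output of the consistency reduction with the
canonical homomorphism from the power with exponent `𝓕 K`. -/
def Hom.consPow {D : Str.{v} S'} (g : Hom (consReduction k A B X) D) (K : SmallSet X k) :
    Hom (B.pow (kConsistency k X A K)) D where
  map t b := g.map t (Quot.mk _ ⟨K, b⟩)
  map_rel R b hb := g.map_rel R (fun i => Quot.mk _ ⟨K, b i⟩) ⟨K, b, hb, rfl⟩

theorem Hom.consPow_restrict {D : Str.{v} S'} (g : Hom (consReduction k A B X) D)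
    {L K : SmallSet X k} (hLK : L.1 ⊆ K.1) (t : S'.Ty) (b : kConsistency k X A L → B.dom t) :
    (g.consPow K).map t (fun f => b (kConsistency.restrict hLK f)) = (g.consPow L).map t b :=
  congrArg (g.map t) (Quot.sound (ConsIdent.glue L K hLK b))

end ConsReduction

section Soundness

variable {S S' : Sig} {T : PromiseTemplate.{u} S} {T' : PromiseTemplate.{v} S'} {X : Str.{0} S}
  {k : ℕ}

/-- The element `(𝓕 K, g.consPow K)` of `ω(Pol(B, B'))`, of arity `𝓕 K`. -/
def consOmega (g : Hom (consReduction k T.yes T'.yes X) T'.no) (K : SmallSet X k)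
    [Finite (kConsistency k X T.yes K)] : (omega (Pol T')).obj (kConsistency k X T.yes K) :=
  ⟨Set.univ, (Pol T').map (fun x => ⟨x, Set.mem_univ x⟩) (g.consPow K)⟩

theorem consOmega_eq_map (g : Hom (consReduction k T.yes T'.yes X) T'.no) {L K : SmallSet X k}
    (hLK : L.1 ⊆ K.1) [Finite (kConsistency k X T.yes K)] [Finite (kConsistency k X T.yes L)] :
    consOmega g L = (omega (Pol T')).map (kConsistency.restrict hLK) (consOmega g K) := by
  have himage := (Set.image_univ_of_surjective
    (kConsistency.restrict_surjective (A := T.yes) hLK)).symm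
  have hminor : g.consPow L = (Pol T').map (kConsistency.restrict hLK) (g.consPow K) :=
    Hom.ext_map fun t b => (g.consPow_restrict hLK t b).symm
  refine omega_ext (Pol T') himage _ _ (fun z => ⟨z.1, himage ▸ z.2⟩) (fun _ => rfl) ?_
  rw [hminor]
  rfl

/-- The values of a polymorphism of arity `𝓕 K` at the projections `f ↦ f x` for `x ∈ K`. -/
def evalAssignment {K : SmallSet X k} (p : Hom (T.yes.pow (kConsistency k X T.yes K)) T.no) :
    Assignment X T.no K.1 :=
  fun x => p.map x.1.1 fun f => f.1 x

theorem isPartialHom_evalAssignment {K : SmallSet X k}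
    (p : Hom (T.yes.pow (kConsistency k X T.yes K)) T.no) :
    IsPartialHom X T.no (evalAssignment p) := fun R a ha hK =>
  p.map_rel R (fun i f => f.1 ⟨⟨(S.ar R).typ i, a i⟩, hK i⟩) fun f =>
    (isConsistentSystem_kConsistency k X T.yes).1 K f.1 f.2 R a ha hK

/-- The set `U` as a set of at most `l ≥ k` elements. -/
def SmallSet.weaken {l : ℕ} (hkl : k ≤ l) (U : SmallSet X k) : SmallSet X l :=
  ⟨U.1, U.2.trans hkl⟩

theorem homTo_of_homTo_consReduction {d r : ℕ}
    {ξ : ∀ (X : Type) [Finite X], (omega (Pol T')).obj X → Set ((Pol T).obj X)}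
    (hξ : IsDRHom d r (omega (Pol T')) (Pol T) ξ) {k : Fin (r + 1) → ℕ}
    (hk : IsGapSequence T.no d k) (hX : X.IsFinite)
    (h : HomTo (consReduction (k 0) T.yes T'.yes X) T'.no) : HomTo X T.no := by
  obtain ⟨g⟩ := h
  have hfin : ∀ K : SmallSet X (k 0), Finite (kConsistency (k 0) X T.yes K) :=
    finite_kConsistency T.finite_yes
  let up : ∀ i, SmallSet X (k i) → SmallSet X (k 0) := fun i =>
    SmallSet.weaken (hk.1 (Fin.zero_le i))
  refine hk.2 X hX ⟨fun i U => evalAssignment (K := up i U) '' ξ _ (consOmega g (up i U)),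
    fun i U => ⟨(Set.encard_image_le _ _).trans (hξ.card_le _ _), ?_⟩, fun U hU => ?_⟩
  · rintro _ ⟨p, -, rfl⟩
    exact isPartialHom_evalAssignment p
  · have hsub : ∀ i j, i < j → (up j (U j)).1 ⊆ (up i (U i)).1 := fun i j hij => hU i j hij.le
    obtain ⟨i, j, hij, p, hp, _, hp', rfl⟩ := hξ.chain
      (fun i => kConsistency (k 0) X T.yes (up i (U i))) (fun i => consOmega g (up i (U i)))
      (fun i j hij => kConsistency.restrict (hsub i j hij))
      (fun i j hij => consOmega_eq_map g (hsub i j hij)) (fun _ _ _ _ _ => rfl)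
    exact ⟨i, j, hij, _, ⟨p, hp, rfl⟩, _, hp', rfl⟩

theorem consReduces_of_isGapSequence {d r : ℕ}
    {ξ : ∀ (X : Type) [Finite X], (omega (Pol T')).obj X → Set ((Pol T).obj X)}
    (hξ : IsDRHom d r (omega (Pol T')) (Pol T) ξ) {k : Fin (r + 1) → ℕ}
    (hk : IsGapSequence T.no d k) : ConsReduces (k 0) T T' := fun _ hX =>
  ⟨fun h => h.consReduction T'.yes (k 0), mt (homTo_of_homTo_consReduction hξ hk hX)⟩

end Soundness

/-! ## Tuples as valuations -/

/-- The positions of type `t` of an arity, used as variables of type `t`. -/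
abbrev Var {T : Type} (α : Arity T) (t : T) : Type := {i : Fin α.len // α.typ i = t}

namespace Tuple

variable {T : Type} {A : T → Type u} {B : T → Type v} {α β γ : Arity T}

/-- A tuple as a valuation of its positions. -/
def val (x : Tuple A α) (t : T) (i : Var α t) : A t := i.2 ▸ x i.1

/-- The tuple of the entries of `x` at the positions `σ`. -/
def pull (x : Tuple A α) (σ : Tuple (Var α) β) : Tuple A β := map x.val σ

/-- The tuple of all positions of an arity. -/
def positions (α : Arity T) : Tuple (Var α) α := fun i => ⟨i, rfl⟩

theorem val_map (f : ∀ t, A t → B t) (x : Tuple A α) (t : T) (i : Var α t) :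
    (map f x).val t i = f t (x.val t i) := by
  obtain ⟨i, rfl⟩ := i
  rfl

theorem val_map_positions (f : ∀ t, Var α t → A t) : (map f (positions α)).val = f := by
  funext t ⟨i, hi⟩
  subst hi
  rfl

/-- For `φ` the identity or one direction of an equivalence, this computes the entry of a reindexed
tuple at the position that corresponds to `s`. -/
theorem val_comp {ι : Type v} {n : ℕ} {τ : ι → T} (y : ∀ s, A (τ s)) (φ : Fin n → ι) {p : Fin n}
    {s : ι} (hp : φ p = s) (h : τ (φ p) = τ s) :
    val (α := ⟨n, fun i => τ (φ i)⟩) (fun i => y (φ i)) (τ s) ⟨p, h⟩ = y s := by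
  subst hp
  rfl

theorem map_pull (f : ∀ t, A t → B t) (x : Tuple A α) (σ : Tuple (Var α) β) :
    map f (x.pull σ) = (map f x).pull σ :=
  funext fun _ => (val_map f x _ _).symm

theorem pull_pull (x : Tuple A α) (σ : Tuple (Var α) β) (τ : Tuple (Var β) γ) :
    (x.pull σ).pull τ = x.pull (σ.pull τ) :=
  (map_pull x.val σ τ).symm

end Tuple

section Flatten

variable {T : Type} {A : T → Type u} {n : ℕ} {β β' : Fin n → Arity T}

/-- The concatenation of a finite sequence of arities. -/
abbrev Arity.flatten (β : Fin n → Arity T) : Arity T := Arity.concat (T' := Fin n) ⟨n, id⟩ β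

theorem Arity.len_flatten_le {k : ℕ} (hβ : ∀ i, (β i).len ≤ k) : (flatten β).len ≤ n * k :=
  (Finset.sum_le_card_nsmul Finset.univ (fun i => (β i).len) k fun i _ => hβ i).trans_eq (by simp)

namespace Tuple

/-- The concatenation of a finite sequence of tuples. -/
abbrev flatten (a : ∀ i, Tuple A (β i)) : Tuple A (Arity.flatten β) :=
  Tuple.concat (T' := Fin n) (α := ⟨n, id⟩) a

/-- The positions of the `i`-th block of a concatenation. -/
def block (β : Fin n → Arity T) (i : Fin n) : Tuple (Var (Arity.flatten β)) (β i) :=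
  fun j => ⟨finSigmaFinEquiv (⟨i, j⟩ : Σ i, Fin (β i).len),
    congrArg (fun s : Σ i, Fin (β i).len => (β s.1).typ s.2)
      (finSigmaFinEquiv.symm_apply_apply (⟨i, j⟩ : Σ i, Fin (β i).len))⟩

theorem flatten_pull_block (a : ∀ i, Tuple A (β i)) (i : Fin n) :
    (flatten a).pull (block β i) = a i :=
  funext fun j => val_comp (fun s : Σ i, Fin (β i).len => a s.1 s.2) finSigmaFinEquiv.symm
    (finSigmaFinEquiv.symm_apply_apply (⟨i, j⟩ : Σ i, Fin (β i).len)) _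

/-- The tuple of positions of a concatenation that pulls back the `i`-th block along `σ i`. -/
def blockwise (σ : ∀ i, Tuple (Var (β i)) (β' i)) :
    Tuple (Var (Arity.flatten β)) (Arity.flatten β') :=
  flatten fun i => (block β i).pull (σ i)

theorem pull_blockwise_pull_block (g : Tuple A (Arity.flatten β))
    (σ : ∀ i, Tuple (Var (β i)) (β' i)) (i : Fin n) :
    (g.pull (blockwise σ)).pull (block β' i) = (g.pull (block β i)).pull (σ i) := by
  rw [pull_pull, pull_pull, blockwise, flatten_pull_block]

theorem flatten_pull_blockwise (a : ∀ i, Tuple A (β i)) (σ : ∀ i, Tuple (Var (β i)) (β' i)) :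
    (flatten a).pull (blockwise σ) = flatten fun i => (a i).pull (σ i) := by
  change flatten (fun i => (flatten a).pull ((block β i).pull (σ i))) = _
  simp only [← pull_pull, flatten_pull_block]

end Tuple

end Flatten

/-! ## The canonical Datalog program -/

section CanonicalProgram

variable {S : Sig}

instance (S : Sig) : Finite S.Ty := S.finite_ty

instance (S : Sig) : Finite S.Sym := S.finite_sym

theorem Str.IsFinite.finite_tuple {A : Str.{u} S} (hA : A.IsFinite) (α : Arity S.Ty) :
    Finite (Tuple A.dom α) :=
  have : ∀ i : Fin α.len, Finite (A.dom (α.typ i)) := fun _ => hA _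
  inferInstance

/-- The relations on `A` of arities of length at most `N`. They are the IDB symbols of the canonical
program. -/
structure SmallRel (A : Str.{0} S) (N : ℕ) where
  arity : Arity S.Ty
  len_le : arity.len ≤ N
  tuples : Set (Tuple A.dom arity)

theorem finite_smallRel {A : Str.{0} S} (hA : A.IsFinite) (N : ℕ) : Finite (SmallRel A N) :=
  have := hA.finite_tuple
  Finite.of_surjective
    (fun p : Σ (n : Fin (N + 1)) (t : Fin n → S.Ty), Set (Tuple A.dom ⟨n, t⟩) =>
      ⟨⟨p.1, p.2.1⟩, Nat.le_of_lt_succ p.1.2, p.2.2⟩)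
    fun ⟨⟨n, t⟩, h, F⟩ => ⟨⟨⟨n, Nat.lt_succ_of_le h⟩, t, F⟩, rfl⟩

/-- The relation `p` as a relation of arity of length at most `N ≥ k`. -/
def SmallRel.weaken {A : Str.{0} S} {k N : ℕ} (hkN : k ≤ N) (p : SmallRel A k) : SmallRel A N :=
  ⟨p.arity, p.len_le.trans hkN, p.tuples⟩

/-- The interpretation in `A` of the symbols of the canonical program: an IDB symbol denotes the
relation it is. -/
def SmallRel.interp (A : Str.{0} S) (N : ℕ) :
    ∀ s : S.Sym ⊕ SmallRel A N, Set (Tuple A.dom (extArity S SmallRel.arity s))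
  | .inl R => A.rel R
  | .inr p => p.tuples

/-- A rule is valid in `A` if it is satisfied by the relations named by the IDB symbols. -/
def DatalogRule.IsValid {A : Str.{0} S} {N : ℕ}
    (ρ : DatalogRule S (SmallRel.arity (A := A) (N := N))) : Prop :=
  ∀ g : (∀ t, Fin (ρ.vars t) → A.dom t),
    (∀ a ∈ ρ.body, a.Holds (SmallRel.interp A N) g) → Tuple.map g ρ.headArgs ∈ ρ.headSym.tuples

/-- The data of a rule with at most `N` variables of each type and a body of relational atoms, given
as a set so that there are finitely many such rules. -/
abbrev CanonicalRule (A : Str.{0} S) (N : ℕ) : Type :=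
  Σ (c : S.Ty → Fin (N + 1)) (p : SmallRel A N), Tuple (fun t => Fin (c t)) p.arity ×
    Set (Σ s : S.Sym ⊕ SmallRel A N, Tuple (fun t => Fin (c t)) (extArity S SmallRel.arity s))

theorem finite_canonicalRule {A : Str.{0} S} (hA : A.IsFinite) (N : ℕ) :
    Finite (CanonicalRule A N) :=
  have := finite_smallRel hA N
  inferInstance

theorem finite_canonicalRule_body {A : Str.{0} S} (hA : A.IsFinite) {N : ℕ}
    (ρ : CanonicalRule A N) : ρ.2.2.2.Finite :=
  have := finite_smallRel hA N
  Set.toFinite _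

/-- The Datalog rule given by the data of a canonical rule. -/
noncomputable def CanonicalRule.toRule {A : Str.{0} S} (hA : A.IsFinite) {N : ℕ}
    (ρ : CanonicalRule A N) : DatalogRule S (SmallRel.arity (A := A) (N := N)) where
  vars t := ρ.1 t
  headSym := ρ.2.1
  headArgs := ρ.2.2.1
  body := (finite_canonicalRule_body hA ρ).toFinset.toList.map fun a => Atom.rel a.1 a.2

theorem CanonicalRule.forall_mem_body {A : Str.{0} S} {hA : A.IsFinite} {N : ℕ}
    {ρ : CanonicalRule A N} {P : Atom _ _ → Prop} :
    (∀ a ∈ (ρ.toRule hA).body, P a) ↔ ∀ a ∈ ρ.2.2.2, P (.rel a.1 a.2) :=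
  List.forall_mem_map.trans (forall_congr' fun _ => imp_congr_left
    (Finset.mem_toList.trans (Set.Finite.mem_toFinset _)))

/-- The canonical Datalog program of width `N` for `A`, which consists of all rules that are valid
in `A`. -/
noncomputable def canonicalProgram {A : Str.{0} S} (hA : A.IsFinite) (N : ℕ) (p : SmallRel A N) :
    DatalogProgram S where
  idb := SmallRel A N
  finite_idb := finite_smallRel hA N
  idbAr := SmallRel.arity
  rules :=
    have := finite_canonicalRule hA N
    ({ρ : CanonicalRule A N | (ρ.toRule hA).IsValid}.toFinite.toFinset.toList).map fun ρ =>
      ρ.toRule hA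
  out := .inr p

theorem mem_rules_canonicalProgram {A : Str.{0} S} {hA : A.IsFinite} {N : ℕ} {p : SmallRel A N}
    {ρ : DatalogRule S (SmallRel.arity (A := A) (N := N))} :
    ρ ∈ (canonicalProgram hA N p).rules ↔
      ∃ ρ' : CanonicalRule A N, (ρ'.toRule hA).IsValid ∧ ρ'.toRule hA = ρ :=
  List.mem_map.trans (by simp only [Finset.mem_toList, Set.Finite.mem_toFinset, Set.mem_ofPred_eq])

theorem Atom.Holds.mono {T Rel : Type} {ar : Rel → Arity T} {V : T → Type} {A : T → Type u}
    {I J : ∀ R, Set (Tuple A (ar R))} (hIJ : ∀ R, I R ⊆ J R) {h : ∀ t, V t → A t}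
    {a : Atom ar V} (ha : a.Holds I h) : a.Holds J h := by
  cases a with
  | rel R x => exact hIJ R ha
  | eq t x y => exact ha

theorem DatalogProgram.isClosedUnder_fixpoint (P : DatalogProgram S) (X : Str.{u} S) :
    P.IsClosedUnder X (P.fixpoint X) := by
  intro ρ hρ h hbody I hI
  refine hI ρ hρ h fun a ha => (hbody a ha).mono fun R => ?_
  cases R with
  | inl R => exact subset_rfl
  | inr p => exact fun x hx => hx I hI

theorem DatalogProgram.fixpoint_out (P : DatalogProgram S) (s : S.Sym ⊕ P.idb) (X : Str.{u} S) :
    DatalogProgram.fixpoint { P with out := s } X = P.fixpoint X := by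
  have hinterp : DatalogProgram.interp { P with out := s } X = P.interp X := by
    funext I s
    cases s <;> rfl
  unfold fixpoint IsClosedUnder
  rw [hinterp]

/-- The tuples of `X` for which the canonical program derives the relation `p`. -/
def Derived {A : Str.{0} S} (hA : A.IsFinite) {N : ℕ} (X : Str.{u} S) (p : SmallRel A N) :
    Set (Tuple X.dom p.arity) :=
  (canonicalProgram hA N p).fixpoint X p

variable {A : Str.{0} S} (hA : A.IsFinite) {N : ℕ} {X : Str.{u} S}

theorem fixpoint_canonicalProgram (p : SmallRel A N) :
    (canonicalProgram hA N p).fixpoint X = Derived hA X :=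
  funext fun q => congrFun
    (((canonicalProgram hA N p).fixpoint_out (canonicalProgram hA N q).out X).symm) q

theorem Derived.map_mem {p : SmallRel A N} {x : Tuple X.dom p.arity}
    (hx : x ∈ Derived hA X p) (f : Hom X A) : Tuple.map f.map x ∈ p.tuples := by
  refine hx (fun p => {x | Tuple.map f.map x ∈ p.tuples}) fun ρ hρ h hbody => ?_
  obtain ⟨ρ, hvalid, rfl⟩ := mem_rules_canonicalProgram.mp hρ
  refine hvalid (fun t v => f.map t (h t v)) fun a ha => ?_
  have hbody := hbody a ha
  rcases a with ⟨R | q, y⟩ | ⟨t, y, z⟩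
  · exact f.map_rel R _ hbody
  · exact hbody
  · exact congrArg (f.map t) hbody

/-- The program contains the rule whose body consists of all the atoms that hold at `h` in `X`. -/
theorem map_mem_derived_of_fin {c : S.Ty → ℕ} (hc : ∀ t, c t ≤ N) (h : ∀ t, Fin (c t) → X.dom t)
    (p : SmallRel A N) (σ : Tuple (fun t => Fin (c t)) p.arity)
    (hσ : ∀ g : ∀ t, Fin (c t) → A.dom t,
      (∀ (q : SmallRel A N) τ, Tuple.map h τ ∈ Derived hA X q → Tuple.map g τ ∈ q.tuples) →
      (∀ R τ, Tuple.map h τ ∈ X.rel R → Tuple.map g τ ∈ A.rel R) → Tuple.map g σ ∈ p.tuples) :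
    Tuple.map h σ ∈ Derived hA X p := by
  let ρ : CanonicalRule A N := ⟨fun t => ⟨c t, Nat.lt_succ_of_le (hc t)⟩, p, σ,
    {a | Tuple.map h a.2 ∈ (canonicalProgram hA N p).interp X (Derived hA X) a.1}⟩
  have hvalid : (ρ.toRule hA).IsValid := fun g hg =>
    have hg := CanonicalRule.forall_mem_body.mp hg
    hσ g (fun q τ => hg ⟨.inr q, τ⟩) (fun R τ => hg ⟨.inl R, τ⟩)
  have hclosed := (canonicalProgram hA N p).isClosedUnder_fixpoint X
  rw [fixpoint_canonicalProgram] at hclosed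
  exact hclosed (ρ.toRule hA) (mem_rules_canonicalProgram.mpr ⟨ρ, hvalid, rfl⟩) h
    (CanonicalRule.forall_mem_body.mpr fun _ ha => ha)

theorem map_mem_derived {V : S.Ty → Type} [∀ t, Finite (V t)] (hV : ∀ t, Nat.card (V t) ≤ N)
    (h : ∀ t, V t → X.dom t) (p : SmallRel A N) (σ : Tuple V p.arity)
    (hσ : ∀ g : ∀ t, V t → A.dom t,
      (∀ (q : SmallRel A N) τ, Tuple.map h τ ∈ Derived hA X q → Tuple.map g τ ∈ q.tuples) →
      (∀ R τ, Tuple.map h τ ∈ X.rel R → Tuple.map g τ ∈ A.rel R) → Tuple.map g σ ∈ p.tuples) :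
    Tuple.map h σ ∈ Derived hA X p := by
  let e : ∀ t, V t ≃ Fin (Nat.card (V t)) := fun t => Finite.equivFin _
  have hsymm : ∀ {D : S.Ty → Type u} (f : ∀ t, V t → D t) {β : Arity S.Ty} (τ : Tuple V β),
      Tuple.map (fun t j => f t ((e t).symm j)) (Tuple.map (fun t => e t) τ) = Tuple.map f τ :=
    fun f β τ => funext fun i => congrArg (f _) ((e _).symm_apply_apply _)
  rw [← hsymm h]
  refine map_mem_derived_of_fin hA hV _ p _ fun g hder hrel => ?_
  refine hσ (fun t v => g t (e t v)) (fun q τ hτ => ?_) fun R τ hτ => ?_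
  · exact hder q (Tuple.map (fun t => e t) τ) ((hsymm h τ).symm ▸ hτ)
  · exact hrel R (Tuple.map (fun t => e t) τ) ((hsymm h τ).symm ▸ hτ)

variable (N) in
/-- The tuples of `A` that satisfy all the atoms that are derived for `x`. -/
def derivedTuples {α : Arity S.Ty} (x : Tuple X.dom α) : Set (Tuple A.dom α) :=
  {f | (∀ (p : SmallRel A N) (σ : Tuple (Var α) p.arity),
      x.pull σ ∈ Derived hA X p → f.pull σ ∈ p.tuples) ∧
    ∀ (R : S.Sym) (σ : Tuple (Var α) (S.ar R)), x.pull σ ∈ X.rel R → f.pull σ ∈ A.rel R}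

theorem pull_mem_derived_iff {α : Arity S.Ty} (hα : α.len ≤ N) (x : Tuple X.dom α)
    (p : SmallRel A N) (σ : Tuple (Var α) p.arity) :
    x.pull σ ∈ Derived hA X p ↔ ∀ f ∈ derivedTuples hA N x, f.pull σ ∈ p.tuples := by
  refine ⟨fun h f hf => hf.1 p σ h, fun hp => ?_⟩
  have hcard : ∀ t, Nat.card (Var α t) ≤ N := fun t =>
    (Finite.card_subtype_le _).trans (by simpa using hα)
  refine map_mem_derived hA hcard x.val p σ fun g hder hrel => ?_
  rw [← Tuple.val_map_positions g] at hder hrel ⊢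
  exact hp (Tuple.map g (Tuple.positions α)) ⟨hder, hrel⟩

theorem mem_derived_iff {p : SmallRel A N} (x : Tuple X.dom p.arity) :
    x ∈ Derived hA X p ↔ derivedTuples hA N x ⊆ p.tuples :=
  pull_mem_derived_iff hA p.len_le x p (Tuple.positions p.arity)

theorem derivedTuples_pull {α β : Arity S.Ty} (hα : α.len ≤ N) (hβ : β.len ≤ N)
    (x : Tuple X.dom α) (σ : Tuple (Var α) β) :
    derivedTuples hA N (x.pull σ) = (fun f => f.pull σ) '' derivedTuples hA N x := by
  apply Set.Subset.antisymm
  · let p : SmallRel A N := ⟨β, hβ, (fun f => f.pull σ) '' derivedTuples hA N x⟩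
    exact (mem_derived_iff hA (p := p) (x.pull σ)).mp
      ((pull_mem_derived_iff hA hα x p σ).mpr fun f hf => ⟨f, hf, rfl⟩)
  · rintro _ ⟨f, hf, rfl⟩
    refine ⟨fun p τ hτ => ?_, fun R τ hτ => ?_⟩
    · rw [Tuple.pull_pull] at hτ ⊢
      exact hf.1 p _ hτ
    · rw [Tuple.pull_pull] at hτ ⊢
      exact hf.2 R _ hτ

end CanonicalProgram

/-! ## Consistency by the canonical program -/

section Assignment

variable {S : Sig} {X : Str.{u} S} {A : Str.{v} S} {K L : Finset X.Elem}

/-- The arity that lists the types of the elements of a finite set. It makes assignments on the set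
tuples, in the order given by `Finset.equivFin`. -/
noncomputable def setArity (K : Finset X.Elem) : Arity S.Ty :=
  ⟨K.card, fun i => (K.equivFin.symm i).1.1⟩

/-- The position of an element of a finite set. -/
noncomputable def setVar {x : X.Elem} (hx : x ∈ K) : Var (setArity K) x.1 :=
  ⟨K.equivFin ⟨x, hx⟩, by simp only [setArity, Equiv.symm_apply_apply]⟩

/-- The positions of the elements of a subset. -/
noncomputable def setVars (h : L ⊆ K) : Tuple (Var (setArity K)) (setArity L) :=
  fun i => setVar (h (L.equivFin.symm i).2)

/-- An assignment as a tuple. -/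
noncomputable def Assignment.toTuple (f : Assignment X A K) : Tuple A.dom (setArity K) :=
  fun i => f (K.equivFin.symm i)

/-- A tuple as an assignment. -/
noncomputable def Assignment.ofTuple (f : Tuple A.dom (setArity K)) : Assignment X A K :=
  fun x => f.val x.1.1 (setVar x.2)

/-- The elements of a finite set as a tuple. -/
noncomputable def setTuple (K : Finset X.Elem) : Tuple X.dom (setArity K) :=
  Assignment.toTuple (A := X) fun x => x.1.2

namespace Assignment

theorem toTuple_val (f : Assignment X A K) {x : X.Elem} (hx : x ∈ K) :
    f.toTuple.val x.1 (setVar hx) = f ⟨x, hx⟩ :=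
  Tuple.val_comp (τ := fun x : {x // x ∈ K} => x.1.1) f K.equivFin.symm
    (K.equivFin.symm_apply_apply ⟨x, hx⟩) _

theorem ofTuple_toTuple (f : Assignment X A K) : ofTuple f.toTuple = f :=
  funext fun x => f.toTuple_val x.2

theorem toTuple_ofTuple (f : Tuple A.dom (setArity K)) : (ofTuple (X := X) f).toTuple = f :=
  funext fun i => Tuple.val_comp f id (K.equivFin.apply_symm_apply i) _

theorem toTuple_pull (f : Assignment X A K) {α : Arity S.Ty} (a : Tuple X.dom α)
    (hK : ∀ i, (⟨α.typ i, a i⟩ : X.Elem) ∈ K) :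
    f.toTuple.pull (fun i => setVar (hK i)) = fun i => f ⟨⟨α.typ i, a i⟩, hK i⟩ :=
  funext fun i => f.toTuple_val (hK i)

theorem toTuple_pull_setVars (h : L ⊆ K) (f : Assignment X A K) :
    f.toTuple.pull (setVars h) = (restrict h f).toTuple :=
  funext fun i => f.toTuple_val (h (L.equivFin.symm i).2)

theorem ofTuple_pull_setVars (h : L ⊆ K) (f : Tuple A.dom (setArity K)) :
    ofTuple (f.pull (setVars h)) = restrict h (ofTuple f) := by
  conv_lhs => rw [← toTuple_ofTuple f]
  rw [toTuple_pull_setVars, ofTuple_toTuple]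

end Assignment

theorem setTuple_pull_setVars (h : L ⊆ K) : (setTuple K).pull (setVars h) = setTuple L :=
  Assignment.toTuple_pull_setVars h _

end Assignment

section DerivedAssignments

variable {S : Sig} {A : Str.{0} S} (hA : A.IsFinite) {k N : ℕ} {X : Str.{u} S}

variable (N) in
/-- The assignments on `K` that satisfy all the atoms that the canonical program derives for the
elements of `K`. -/
def derivedAssignments (K : Finset X.Elem) : Set (Assignment X A K) :=
  {f | f.toTuple ∈ derivedTuples hA N (setTuple K)}

theorem ofTuple_mem_derivedAssignments {K : Finset X.Elem} {f : Tuple A.dom (setArity K)}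
    (hf : f ∈ derivedTuples hA N (setTuple K)) :
    Assignment.ofTuple f ∈ derivedAssignments hA N K := by
  change (Assignment.ofTuple f).toTuple ∈ derivedTuples hA N (setTuple K)
  rwa [Assignment.toTuple_ofTuple]

theorem derivedTuples_setTuple_eq_image {K L : Finset X.Elem} (hK : K.card ≤ N) (hLK : L ⊆ K) :
    derivedTuples hA N (setTuple L) =
      (fun f => f.pull (setVars hLK)) '' derivedTuples hA N (setTuple K) := by
  rw [← setTuple_pull_setVars hLK]
  exact derivedTuples_pull hA hK ((Finset.card_le_card hLK).trans hK) _ _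

theorem isPartialHom_of_mem_derivedAssignments {K : Finset X.Elem} {f : Assignment X A K}
    (hf : f ∈ derivedAssignments hA N K) : IsPartialHom X A f := by
  intro R a ha hK
  rw [← Assignment.toTuple_pull]
  refine hf.2 R _ ?_
  rwa [setTuple, Assignment.toTuple_pull]

theorem isConsistentSystem_derivedAssignments (hkN : k ≤ N) :
    IsConsistentSystem k X A fun K => derivedAssignments hA N K.1 := by
  refine ⟨fun K f => isPartialHom_of_mem_derivedAssignments hA, fun L K hLK => ⟨?_, ?_⟩⟩
  · intro h hh
    obtain ⟨f, hf, hfh⟩ := (derivedTuples_setTuple_eq_image hA (K.2.trans hkN) hLK).subset hh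
    refine ⟨Assignment.ofTuple f, ofTuple_mem_derivedAssignments hA hf, ?_⟩
    rw [← Assignment.ofTuple_pull_setVars, ← Assignment.ofTuple_toTuple h]
    exact congrArg _ hfh
  · intro g hg
    exact (derivedTuples_setTuple_eq_image hA (K.2.trans hkN) hLK).superset
      ⟨g.toTuple, hg, Assignment.toTuple_pull_setVars hLK g⟩

theorem ofTuple_mem_kConsistency (hkN : k ≤ N) (K : SmallSet X k) {f : Tuple A.dom (setArity K.1)}
    (hf : f ∈ derivedTuples hA N (setTuple K.1)) :
    Assignment.ofTuple f ∈ kConsistency k X A K :=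
  ⟨_, isConsistentSystem_derivedAssignments hA hkN, ofTuple_mem_derivedAssignments hA hf⟩

end DerivedAssignments

/-! ## The Datalog reduction -/

section DatalogReduction

variable {S S' : Sig}

theorem HomTo.trans {A : Str.{u} S} {B : Str.{v} S} {C : Str.{w} S} (h : HomTo A B)
    (h' : HomTo B C) : HomTo A C := by
  obtain ⟨f⟩ := h
  obtain ⟨g⟩ := h'
  exact ⟨⟨fun t a => g.map t (f.map t a), fun R a ha => g.map_rel R _ (f.map_rel R a ha)⟩⟩

/-- The elements of type `t` of the powers of `B` whose exponents are relations of small arity on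
`A`. -/
structure PowIndex (A : Str.{0} S) (B : Str.{0} S') (k : ℕ) (t : S'.Ty) where
  exponent : SmallRel A k
  elem : exponent.tuples → B.dom t

theorem finite_powIndex {A : Str.{0} S} {B : Str.{0} S'} (hA : A.IsFinite) (hB : B.IsFinite)
    (k : ℕ) (t : S'.Ty) : Finite (PowIndex A B k t) :=
  have := finite_smallRel hA k
  have := fun p : SmallRel A k => hA.finite_tuple p.arity
  have := hB t
  Finite.of_surjective (fun p : Σ F : SmallRel A k, F.tuples → B.dom t => ⟨p.1, p.2⟩)
    fun ⟨F, b⟩ => ⟨⟨F, b⟩, rfl⟩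

/-- The intermediate signature of the Datalog reduction: its types and symbols are those of `S'`
labelled by indices. -/
def consSig {A : Str.{0} S} {B : Str.{0} S'} (hA : A.IsFinite) (hB : B.IsFinite) (k : ℕ) :
    Sig where
  Ty := Σ t, PowIndex A B k t
  Sym := Σ R : S'.Sym, ∀ i : Fin (S'.ar R).len, PowIndex A B k ((S'.ar R).typ i)
  finite_ty := have := finite_powIndex hA hB k; inferInstance
  finite_sym := have := finite_powIndex hA hB k; inferInstance
  ar s := ⟨(S'.ar s.1).len, fun i => ⟨(S'.ar s.1).typ i, s.2 i⟩⟩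

variable {A : Str.{0} S} {B : Str.{0} S'} {k N : ℕ}

/-- The relation on `A` that holds at the concatenation of elements `f i` of the exponents of `e` if
the values of `e` at these elements are in the relation `R` of `B`. -/
def powRel (hRN : ∀ R, (S'.ar R).len * k ≤ N) (R : S'.Sym)
    (e : ∀ i : Fin (S'.ar R).len, PowIndex A B k ((S'.ar R).typ i)) : SmallRel A N where
  arity := Arity.flatten fun i => (e i).exponent.arity
  len_le := (Arity.len_flatten_le fun i => (e i).exponent.len_le).trans (hRN R)
  tuples := {g | ∃ h : ∀ i, g.pull (Tuple.block _ i) ∈ (e i).exponent.tuples,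
    (fun i => (e i).elem ⟨g.pull (Tuple.block _ i), h i⟩) ∈ B.rel R}

variable (hA : A.IsFinite) (hB : B.IsFinite) (hkN : k ≤ N) (hRN : ∀ R, (S'.ar R).len * k ≤ N)

/-- The Datalog interpretation whose domains consist of the tuples for which the exponent is derived
by the canonical program. -/
noncomputable def consInterpretation : DatalogInterpretation S (consSig (B := B) hA hB k) where
  dom s := canonicalProgram hA N (s.2.exponent.weaken hkN)
  rel s := canonicalProgram hA N (powRel hRN s.1 s.2)
  arity_rel _ := rfl

/-- The union gadget that forgets the indices. -/
def consGadget : UnionGadget (consSig (A := A) (B := B) hA hB k) S' where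
  d := Sigma.fst
  r := Sigma.fst
  arity_r _ := rfl

/-- The output of the Datalog reduction. -/
noncomputable def datalogReduction (X : Str.{u} S) : Str.{u} S' :=
  (consGadget (B := B) hA hB).apply ((consInterpretation (N := N) hA hB hkN hRN).apply X)

theorem HomTo.datalogReduction {X : Str.{u} S} (h : HomTo X A) :
    HomTo (datalogReduction hA hB hkN hRN X) B := by
  obtain ⟨f⟩ := h
  refine ⟨⟨fun t y => y.1.2 ▸ y.1.1.2.elem ⟨Tuple.map f.map y.2.1, Derived.map_mem hA y.2.2 f⟩,
    ?_⟩⟩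
  rintro _ _ ⟨⟨R, e⟩, a, ha⟩
  obtain ⟨h, hrel⟩ := Derived.map_mem (p := powRel hRN R e) hA ha f
  have hblock : ∀ i, (Tuple.map f.map (Tuple.flatten fun i => (a i).1)).pull (Tuple.block _ i) =
      Tuple.map f.map (a i).1 := fun i =>
    (Tuple.map_pull _ _ _).symm.trans (congrArg _ (Tuple.flatten_pull_block _ i))
  have hvalue : (fun i => (e i).elem ⟨_, h i⟩) = fun i => (e i).elem
      ⟨Tuple.map f.map (a i).1, Derived.map_mem (p := (e i).exponent.weaken hkN) hA (a i).2 f⟩ :=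
    funext fun i => congrArg (e i).elem (Subtype.ext (hblock i))
  rw [hvalue] at hrel
  exact hrel

variable {X : Str.{u} S}

variable (B X) in
/-- The elements of type `t` of the output of the Datalog reduction, before they are wrapped by the
union gadget. -/
structure PowElem (t : S'.Ty) where
  index : PowIndex A B k t
  tuple : Tuple X.dom index.exponent.arity
  derived : tuple ∈ Derived hA X (index.exponent.weaken hkN)

namespace PowElem

variable {hA hkN}

/-- The element of the output of the Datalog reduction. -/
def toDom {t : S'.Ty} (y : PowElem B hA hkN X t) : (datalogReduction hA hB hkN hRN X).dom t :=
  ⟨⟨⟨t, y.index⟩, rfl⟩, y.tuple, y.derived⟩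

/-- Membership in a relation of the output of the Datalog reduction. -/
def Rel (R : S'.Sym) (y : ∀ i, PowElem B hA hkN X ((S'.ar R).typ i)) : Prop :=
  Tuple.flatten (fun i => (y i).tuple) ∈ Derived hA X (powRel hRN R fun i => (y i).index)

theorem Rel.toDom_mem {R : S'.Sym} {y : ∀ i, PowElem B hA hkN X ((S'.ar R).typ i)}
    (h : Rel hRN R y) :
    (fun i => (y i).toDom hB hRN) ∈ (datalogReduction hA hB hkN hRN X).rel R :=
  UnionGadget.Rel.intro (υ := consGadget hA hB)
    (A := (consInterpretation hA hB hkN hRN).apply X) ⟨R, fun i => (y i).index⟩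
    (fun i => ⟨(y i).tuple, (y i).derived⟩) h

theorem pull_block_mem {n : ℕ} {t : Fin n → S'.Ty} (y : ∀ i, PowElem B hA hkN X (t i))
    {g : Tuple A.dom (Arity.flatten fun i => (y i).index.exponent.arity)}
    (hg : g ∈ derivedTuples hA N (Tuple.flatten fun i => (y i).tuple)) (i : Fin n) :
    g.pull (Tuple.block _ i) ∈ (y i).index.exponent.tuples :=
  hg.1 ((y i).index.exponent.weaken hkN) (Tuple.block _ i)
    ((Tuple.flatten_pull_block (fun i => (y i).tuple) i).symm ▸ (y i).derived)

theorem rel_iff {R : S'.Sym} {y : ∀ i, PowElem B hA hkN X ((S'.ar R).typ i)} :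
    Rel hRN R y ↔ ∀ (g : Tuple A.dom (Arity.flatten fun i => (y i).index.exponent.arity))
      (hg : g ∈ derivedTuples hA N (Tuple.flatten fun i => (y i).tuple)),
      (fun i => (y i).index.elem ⟨_, pull_block_mem y hg i⟩) ∈ B.rel R :=
  (mem_derived_iff hA (p := powRel hRN R fun i => (y i).index) _).trans
    (forall₂_congr fun _ hg => exists_prop_of_true (pull_block_mem y hg))

/-- The element `y'` is obtained from `y` by restriction along a map of positions. -/
def Step {t : S'.Ty} (y y' : PowElem B hA hkN X t) : Prop :=
  ∃ σ : Tuple (Var y.index.exponent.arity) y'.index.exponent.arity, y'.tuple = y.tuple.pull σ ∧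
    ∀ f : y.index.exponent.tuples, ∃ h : f.1.pull σ ∈ y'.index.exponent.tuples,
      y'.index.elem ⟨f.1.pull σ, h⟩ = y.index.elem f

theorem Step.refl {t : S'.Ty} (y : PowElem B hA hkN X t) : Step y y :=
  ⟨Tuple.positions _, rfl, fun f => ⟨f.2, rfl⟩⟩

theorem rel_iff_of_step {R : S'.Sym} {y y' : ∀ i, PowElem B hA hkN X ((S'.ar R).typ i)}
    (h : ∀ i, Step (y i) (y' i)) : Rel hRN R y ↔ Rel hRN R y' := by
  choose σ htuple helem using h
  have hlen : ∀ y : ∀ i, PowElem B hA hkN X ((S'.ar R).typ i),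
      (Arity.flatten fun i => (y i).index.exponent.arity).len ≤ N := fun y =>
    (powRel hRN R fun i => (y i).index).len_le
  have hderived : derivedTuples hA N (Tuple.flatten fun i => (y' i).tuple) =
      (fun g => g.pull (Tuple.blockwise σ)) ''
        derivedTuples hA N (Tuple.flatten fun i => (y i).tuple) := by
    rw [← derivedTuples_pull hA (hlen y) (hlen y'), Tuple.flatten_pull_blockwise, funext htuple]
  have hvalue : ∀ (g) (hg : g ∈ derivedTuples hA N (Tuple.flatten fun i => (y i).tuple))
      (hg' : g.pull (Tuple.blockwise σ) ∈
        derivedTuples hA N (Tuple.flatten fun i => (y' i).tuple)),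
      (fun i => (y' i).index.elem ⟨_, pull_block_mem y' hg' i⟩) =
        fun i => (y i).index.elem ⟨_, pull_block_mem y hg i⟩ := fun g hg hg' => funext fun i =>
    (congrArg (y' i).index.elem (Subtype.ext (Tuple.pull_blockwise_pull_block g σ i))).trans
      (helem i ⟨_, pull_block_mem y hg i⟩).2
  rw [rel_iff, rel_iff]
  constructor
  · intro hrel g' hg'
    obtain ⟨g, hg, rfl⟩ := hderived.subset hg'
    exact hvalue g hg hg' ▸ hrel g hg
  · intro hrel g hg
    have hg' := hderived.superset ⟨g, hg, rfl⟩
    exact hvalue g hg hg' ▸ hrel _ hg'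

end PowElem

end DatalogReduction

section Equivalence

open Relation (EqvGen)

variable {ι : Type u} {P : ι → Type v} {step : ∀ i, P i → P i → Prop}

theorem eqvGen_pi_update [DecidableEq ι] (hrefl : ∀ i a, step i a a) (y : ∀ i, P i) {i : ι}
    {a a' : P i} (h : EqvGen (step i) a a') :
    EqvGen (fun y y' => ∀ i, step i (y i) (y' i)) (Function.update y i a)
      (Function.update y i a') := by
  induction h with
  | rel a a' h =>
    refine .rel _ _ fun j => ?_
    rcases eq_or_ne j i with rfl | hj
    · simpa only [Function.update_self] using h
    · simpa only [Function.update_of_ne hj] using hrefl j _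
  | refl => exact .refl _
  | symm _ _ _ ih => exact .symm _ _ ih
  | trans _ _ _ _ _ ih ih' => exact .trans _ _ _ ih ih'

theorem eqvGen_pi [Finite ι] (hrefl : ∀ i a, step i a a) {y y' : ∀ i, P i}
    (h : ∀ i, EqvGen (step i) (y i) (y' i)) :
    EqvGen (fun y y' => ∀ i, step i (y i) (y' i)) y y' := by
  classical
  cases nonempty_fintype ι
  suffices ∀ s : Finset ι, EqvGen (fun y y' => ∀ i, step i (y i) (y' i)) y (s.piecewise y' y) by
    simpa only [Finset.piecewise_univ] using this Finset.univ
  intro s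
  induction s using Finset.induction_on with
  | empty => simpa only [Finset.piecewise_empty] using EqvGen.refl y
  | insert i s hi ih =>
    refine ih.trans _ _ _ ?_
    have hstep := eqvGen_pi_update hrefl (s.piecewise y' y) (h i)
    rwa [← Finset.piecewise_eq_of_notMem s y' y hi, Function.update_eq_self,
      ← Finset.piecewise_insert] at hstep

end Equivalence

section Comparison

variable {S S' : Sig} {A : Str.{0} S} {B : Str.{0} S'} {k N : ℕ} (hA : A.IsFinite)
  (hB : B.IsFinite) (hkN : k ≤ N) (hRN : ∀ R, (S'.ar R).len * k ≤ N) {X : Str.{0} S}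

/-- The element of the Datalog reduction given by an element `(K; b)` of the consistency reduction
before identification: the exponent is the strongest relation derived for the elements of `K`. -/
noncomputable def ConsPre.toPowElem {t : S'.Ty} (y : ConsPre k A B X t) : PowElem B hA hkN X t where
  index := ⟨⟨setArity y.1.1, y.1.2, derivedTuples hA N (setTuple y.1.1)⟩, fun f =>
    y.2 ⟨Assignment.ofTuple f.1, ofTuple_mem_kConsistency hA hkN y.1 f.2⟩⟩
  tuple := setTuple y.1.1
  derived := (mem_derived_iff hA (p := ⟨setArity y.1.1, y.1.2.trans hkN, _⟩) _).mpr subset_rfl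

theorem ConsIdent.step {t : S'.Ty} {y y' : ConsPre k A B X t} (h : ConsIdent k A B X t y y') :
    (y.toPowElem hA hkN).Step (y'.toPowElem hA hkN) := by
  obtain ⟨L, K, hLK, b⟩ := h
  refine ⟨setVars hLK, (setTuple_pull_setVars hLK).symm, fun f => ⟨?_, ?_⟩⟩
  · exact (derivedTuples_setTuple_eq_image hA (K.2.trans hkN) hLK).superset ⟨f.1, f.2, rfl⟩
  · exact congrArg b (Subtype.ext (Assignment.ofTuple_pull_setVars hLK f.1))

theorem PowElem.rel_of_mem_pow (R : S'.Sym) (K : SmallSet X k)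
    (b : Tuple (B.pow (kConsistency k X A K)).dom (S'.ar R))
    (hb : b ∈ (B.pow (kConsistency k X A K)).rel R) :
    PowElem.Rel hRN R
      fun i => ConsPre.toPowElem (B := B) (t := (S'.ar R).typ i) hA hkN ⟨K, b i⟩ := by
  rw [PowElem.rel_iff]
  intro g hg
  let diagonal : Tuple (Var (setArity K.1)) (Arity.flatten fun _ : Fin (S'.ar R).len =>
    setArity K.1) := Tuple.flatten fun _ => Tuple.positions (setArity K.1)
  have hlen : (Arity.flatten fun _ : Fin (S'.ar R).len => setArity K.1).len ≤ N :=
    (Arity.len_flatten_le fun _ => K.2).trans (hRN R)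
  obtain ⟨f, hf, rfl⟩ :=
    (derivedTuples_pull hA (K.2.trans hkN) hlen (setTuple K.1) diagonal).subset hg
  have hvalue : ∀ i (h : (f.pull diagonal).pull (Tuple.block _ i) ∈
      derivedTuples hA N (setTuple K.1)),
      b i ⟨Assignment.ofTuple _, ofTuple_mem_kConsistency hA hkN K h⟩ =
        b i ⟨Assignment.ofTuple f, ofTuple_mem_kConsistency hA hkN K hf⟩ := fun i h =>
    congrArg (b i) (Subtype.ext (congrArg Assignment.ofTuple
      (Tuple.flatten_pull_block (fun _ => f) i)))
  exact (funext fun i => hvalue i (PowElem.pull_block_mem _ hg i)) ▸ hb _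

theorem homTo_datalogReduction_of_consReduction :
    HomTo (consReduction k A B X) (datalogReduction hA hB hkN hRN X) := by
  let cls : ∀ t, (consReduction k A B X).dom t →
      Quot (PowElem.Step (B := B) (X := X) (hA := hA) (hkN := hkN) (t := t)) := fun t =>
    Quot.map (ConsPre.toPowElem hA hkN) fun _ _ h => h.step hA hkN
  refine ⟨⟨fun t y => (cls t y).out.toDom hB hRN, ?_⟩⟩
  rintro R _ ⟨K, b, hb, rfl⟩
  refine PowElem.Rel.toDom_mem hB hRN ?_
  have hequiv := eqvGen_pi (fun i => PowElem.Step.refl) fun i : Fin (S'.ar R).len =>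
    Quot.eqvGen_exact (Quot.out_eq (cls _ (Quot.mk _ ⟨K, b i⟩))).symm
  have hlift := congrArg (Quot.lift (PowElem.Rel hRN R)
    fun _ _ h => propext (PowElem.rel_iff_of_step hRN h)) (Quot.eqvGen_sound hequiv)
  exact hlift.mp (PowElem.rel_of_mem_pow hA hkN hRN R K b hb)

end Comparison

theorem ConsReduces.dlReduces {S S' : Sig} {T : PromiseTemplate.{u} S}
    {T' : PromiseTemplate.{v} S'} {k : ℕ} (h : ConsReduces k T T') : DLReduces T T' := by
  obtain ⟨M, hM⟩ := (Set.finite_range fun R => (S'.ar R).len).bddAbove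
  have hkN : k ≤ k + M * k := Nat.le_add_right _ _
  have hRN : ∀ R, (S'.ar R).len * k ≤ k + M * k := fun R =>
    (Nat.mul_le_mul_right k (hM (Set.mem_range_self R))).trans (Nat.le_add_left _ _)
  refine ⟨_, consInterpretation T.finite_yes T'.finite_yes hkN hRN,
    consGadget T.finite_yes T'.finite_yes, fun X hX => ⟨fun hXT => ?_, fun hXT hψ => ?_⟩⟩
  · exact hXT.datalogReduction T.finite_yes T'.finite_yes hkN hRN
  · exact (h X hX).2 hXT
      ((homTo_datalogReduction_of_consReduction T.finite_yes T'.finite_yes hkN hRN).trans hψ)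

end PCSPReductions

theorem corollaryC4 {S S' : PCSPReductions.Sig}
    (T : PCSPReductions.PromiseTemplate.{u} S) (T' : PCSPReductions.PromiseTemplate.{v} S')
    (d r : ℕ)
    (hξ : ∃ ξ, PCSPReductions.IsDRHom d r
      (PCSPReductions.omega (PCSPReductions.Pol T')) (PCSPReductions.Pol T) ξ) :
    PCSPReductions.DLReduces T T' ∧
    (∃ k : Fin (r + 1) → ℕ, PCSPReductions.IsGapSequence T.no d k ∧ 1 ≤ k 0) ∧
    (∀ k : Fin (r + 1) → ℕ, PCSPReductions.IsGapSequence T.no d k → 1 ≤ k 0 →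
      PCSPReductions.ConsReduces (k 0) T T') := by
  obtain ⟨ξ, hξ⟩ := hξ
  obtain ⟨k, hk, hk0⟩ := PCSPReductions.exists_isGapSequence T.no d r
  exact ⟨(PCSPReductions.consReduces_of_isGapSequence hξ hk).dlReduces, ⟨k, hk, hk0⟩,
    fun _ hk _ => PCSPReductions.consReduces_of_isGapSequence hξ hk⟩
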